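/- Let $d,M\ge 1$ be integers, let $w\in\mathbb{R}^d$ be a nonzero weight vector (entries of any sign), and for $o,q\in\{0,1,\dots,M\}^d$ put $d_w^{l_1}(o,q)=\sum_{i=1}^d w_i|o_i-q_i|$. For $x\in\{0,\dots,M\}^d$ let $x_{ij}=1$ if $j\le x_i$ and $x_{ij}=0$ otherwise ($1\le i\le d$, $1\le j\le M$), and define the vectors in $\mathbb{R}^{2Md}$ $$P(x)=\big((\cos\tfrac{\pi}{2}x_{ij})_{i,j};(\sin\tfrac{\pi}{2}x_{ij})_{i,j}\big),\qquad Q_w(x)=\big((w_i\cos\tfrac{\pi}{2}x_{ij})_{i,j};(w_i\sin\tfrac{\pi}{2}x_{ij})_{i,j}\big).$$ For $a\in\mathbb{R}^{2Md}$ with independent standard normal entries let $f(o)=h(P(o))$ and $g(q)=h(Q_w(q))$, where $h(y)=0$ if $a^Ty<0$ and $h(y)=1$ if $a^Ty\ge 0$. Let $$P(r)=1-\frac1\pi\arccos\left(\frac{M\sum_{i=1}^d w_i-r}{M\sqrt{d\sum_{i=1}^d w_i^2}}\right),$$ and let $R_1<R_2$ be real thresholds for which $P(R_1)$ and $P(R_2)$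 are defined and $P(R_2)>0$. Then: (i) $\Pr[f(o)=g(q)]=P(d_w^{l_1}(o,q))$ for all $o,q\in\{0,\dots,M\}^d$, and $\rho=\dfrac{\log P(R_1)}{\log P(R_2)}<1$. (ii) The scheme $(d_w^{l_1},\theta)$-ALSH solves $(R_1,R_2)$-NNS over $d_w^{l_1}$ with $O(n^{\rho}d\log n)$ query time and $O(n^{1+\rho})$ space. In detail: the scheme draws $L$ groups of $k$ independent directions $a$; for each group it stores the data points in a hash table, keyed by their $k$ values of $f$ (the data structure uses neither the query nor $w$, except for the choice of $k$ and $L$); to answer a query $(q,w)$, it looks up in each table the bucket keyed by the $k$ values of $g$ at $q$, examines at most $N$ data points in total, and returns the first one at distance at most $R_2$. For every $\delta>0$ there are choices of $k,L,N$, depending only on $n,\delta,P(R_1),P(R_2)$, and a constant $C$, depending only on $\delta,P(R_1),P(R_2)$, such that for all $n\ge2$, every data set of $n$ points $D\subset\{0,\dots,M\}^d$ and every query $q\in\{0,\dots,M\}^d$: with probability at least $1-\delta$ the answer is correct, i.e. if some $o'\in D$ has $d_w^{l_1}(o',q)\le R_1$, then a point $o\in D$ with $d_w^{l_1}(o,q)\le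 R_2$ is returned; the query always takes at most $C\,n^{\rho}d\log n$ unit-cost operations (array accesses, arithmetic operations and comparisons on reals and on integers of $O(\log n)$ bits); the buckets of all tables occupy at most $C\,n^{1+\rho}$ memory cells, and the whole data structure, including the data points and the random directions, at most $C\,dM\,n^{1+\rho}$ memory cells. Here each $k$-bit key is stored in one cell, and $k\le C\log n$. -/

import Mathlib

open MeasureTheory ProbabilityTheory

noncomputable section

namespace ThetaALSH

/-! ### Points, weighted Manhattan distance, transformations, hash family -/

/-- The space of data points and query points, `{0, 1, …, M}^d`. -/
abbrev Point (d M : ℕ) : Type := Fin d → Fin (M + 1)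

/-- The generalized weighted Manhattan distance `∑ i, w i * |o i - q i|`; the weights
may have any sign. -/
def wdist {d M : ℕ} (w : Fin d → ℝ) (o q : Point d M) : ℝ :=
  ∑ i, w i * |((o i : ℕ) : ℝ) - ((q i : ℕ) : ℝ)|

/-- The digit number `j` (counted from `0`) of the unary code of `x`, that is of `x` ones followed
by `M - x` zeros. -/
def unary {M : ℕ} (x : Fin (M + 1)) (j : Fin M) : ℝ :=
  if (j : ℕ) < (x : ℕ) then 1 else 0

/-- Index set of the `2Md` coordinates: `inl (i, j)` for the cosine half,
`inr (i, j)` for the sine half. -/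
abbrev Coord (d M : ℕ) : Type := (Fin d × Fin M) ⊕ (Fin d × Fin M)

/-- The preprocessing transformation, applied to data points. It does not see the weights. -/
def preTrans {d M : ℕ} (o : Point d M) : Coord d M → ℝ
  | Sum.inl (i, j) => Real.cos (Real.pi / 2 * unary (o i) j)
  | Sum.inr (i, j) => Real.sin (Real.pi / 2 * unary (o i) j)

/-- The query transformation for the weight vector `w`. -/
def queryTrans {d M : ℕ} (w : Fin d → ℝ) (q : Point d M) : Coord d M → ℝ
  | Sum.inl (i, j) => w i * Real.cos (Real.pi / 2 * unary (q i) j)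
  | Sum.inr (i, j) => w i * Real.sin (Real.pi / 2 * unary (q i) j)

/-- The sign hash of the vector `x` with respect to the direction `a`. -/
def angularHash {ι : Type} [Fintype ι] (a x : ι → ℝ) : Fin 2 :=
  if ∑ c, a c * x c < 0 then 0 else 1

/-- Hash function for data points. -/
def hashData {d M : ℕ} (a : Coord d M → ℝ) (o : Point d M) : Fin 2 :=
  angularHash a (preTrans o)

/-- Hash function for query points with weight vector `w`. -/
def hashQuery {d M : ℕ} (a : Coord d M → ℝ) (w : Fin d → ℝ) (q : Point d M) : Fin 2 :=
  angularHash a (queryTrans w q)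

/-- Law of one random direction: `2Md` independent standard normal coordinates. -/
def directionLaw (d M : ℕ) : Measure (Coord d M → ℝ) :=
  Measure.pi fun _ => gaussianReal 0 1

/-- The directions used by the whole data structure: `L` tables with `k` directions each. -/
abbrev Seeds (d M k L : ℕ) : Type := Fin L → Fin k → Coord d M → ℝ

/-- All `L * k` directions are drawn independently. -/
def seedLaw (d M k L : ℕ) : Measure (Seeds d M k L) :=
  Measure.pi fun _ => Measure.pi fun _ => directionLaw d M

/-- The cosine of the angle between the two transformed points, when their distance is `r`. -/
def cosAngle {d : ℕ} (M : ℕ) (w : Fin d → ℝ) (r : ℝ) : ℝ :=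
  (M * ∑ i, w i - r) / (M * Real.sqrt (d * ∑ i, w i ^ 2))

/-- The function `P(r)`. -/
def collisionProb {d : ℕ} (M : ℕ) (w : Fin d → ℝ) (r : ℝ) : ℝ :=
  1 - 1 / Real.pi * Real.arccos (cosAngle M w r)

/-- The exponent `ρ`. -/
def rho {d : ℕ} (M : ℕ) (w : Fin d → ℝ) (R₁ R₂ : ℝ) : ℝ :=
  Real.log (collisionProb M w R₁) / Real.log (collisionProb M w R₂)

/-! ### Unit-cost computations

A value of type `Timed α` is the outcome of a computation together with the number of elementary
instructions it has executed. The elementary instructions are those of a random access machine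
whose memory cells hold a real number or an integer: reading one cell of an array, one arithmetic
operation, one comparison. -/

/-- The result of a computation and the number of instructions executed. -/
structure Timed (α : Type) where
  /-- the result -/
  val : α
  /-- the number of instructions executed -/
  steps : ℕ

/-- Sequential composition adds up the instructions. -/
instance : Monad Timed where
  pure a := ⟨a, 0⟩
  bind x f := ⟨(f x.val).val, x.steps + (f x.val).steps⟩

namespace Timed

/-- One instruction with no result (control of a loop). -/
def tick : Timed Unit := ⟨(), 1⟩

/-- Read one cell of an array. -/
def load {ι α : Type} (A : ι → α) (i : ι) : Timed α := ⟨A i, 1⟩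

/-- One addition. -/
def add {α : Type} [Add α] (x y : α) : Timed α := ⟨x + y, 1⟩

/-- One subtraction. -/
def sub {α : Type} [Sub α] (x y : α) : Timed α := ⟨x - y, 1⟩

/-- One multiplication. -/
def mul {α : Type} [Mul α] (x y : α) : Timed α := ⟨x * y, 1⟩

/-- One absolute value. -/
def abs (x : ℝ) : Timed ℝ := ⟨|x|, 1⟩

/-- One integer halving. -/
def half (x : ℕ) : Timed ℕ := ⟨x / 2, 1⟩

open Classical in
/-- One comparison `x < y`. -/
def less {α : Type} [LT α] (x y : α) : Timed Bool := ⟨decide (x < y), 1⟩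

/-- One equality test of integers. -/
def equal (x y : ℕ) : Timed Bool := ⟨decide (x = y), 1⟩

end Timed

/-! ### The data structure -/

/-- The sums of a direction `a` that are stored in place of `a`: for each `i`, the sums of the last
`M - x` entries of the `i`-th block of the cosine half and of the first `x` entries of the `i`-th
block of the sine half, for `x = 0, …, M`. -/
def blockSums {d M : ℕ} (a : Coord d M → ℝ) : Fin d ⊕ Fin d → Fin (M + 1) → ℝ
  | Sum.inl i, x => ∑ j : Fin M, if (x : ℕ) ≤ (j : ℕ) then a (Sum.inl (i, j)) else 0
  | Sum.inr i, x => ∑ j : Fin M, if (j : ℕ) < (x : ℕ) then a (Sum.inr (i, j)) else 0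

/-- The `k` hash bits of a data point, packed into one integer below `2 ^ k`. -/
def dataKey {d M k : ℕ} (a : Fin k → Coord d M → ℝ) (o : Point d M) : ℕ :=
  Nat.ofDigits 2 (List.ofFn fun j => (hashData (a j) o : ℕ))

/-- A hash table: the block sums of its `k` directions, and the data points grouped into buckets,
as an array of numbers of data points sorted by their keys, next to the array of these keys. -/
structure Table (d M k n : ℕ) where
  /-- block sums of the `k` directions -/
  sums : Fin k → Fin d ⊕ Fin d → Fin (M + 1) → ℝ
  /-- the keys, in increasing order -/
  key : Fin n → ℕ
  /-- the number of the data point to which the key at this position belongs -/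
  id : Fin n → Fin n

/-- The data structure: the data points and `L` hash tables. -/
structure Index (d M k L n : ℕ) where
  /-- the data points -/
  data : Fin n → Point d M
  /-- the hash tables -/
  tables : Fin L → Table d M k n

/-- The data structure for the data set `D`. Neither the query nor its weights are involved. -/
def build {d M k L n : ℕ} (D : Fin n → Point d M) (a : Seeds d M k L) : Index d M k L n where
  data := D
  tables t :=
    { sums := fun j => blockSums (a t j)
      key := fun i => dataKey (a t) (D (Tuple.sort (fun m => dataKey (a t) (D m)) i))
      id := fun i => Tuple.sort (fun m => dataKey (a t) (D m)) i }

/-- Number of memory cells taken by the buckets of all tables (keys and point numbers). -/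
def Index.bucketCells {d M k L n : ℕ} (_ : Index d M k L n) : ℕ :=
  L * (n + n)

/-- Number of memory cells of the whole data structure: the coordinates of the data points,
the block sums of the directions of all tables, and the buckets. -/
def Index.cells {d M k L n : ℕ} (S : Index d M k L n) : ℕ :=
  n * d + L * (k * ((d + d) * (M + 1))) + S.bucketCells

/-! ### The query algorithm -/

/-- Add the contributions of the coordinates in the list to the projection of the transformed
query on a direction. -/
def projLoop {d M : ℕ} (s : Fin d ⊕ Fin d → Fin (M + 1) → ℝ) (w : Fin d → ℝ) (q : Point d M) :
    List (Fin d) → ℝ → Timed ℝ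
  | [], acc => pure acc
  | i :: is, acc => do
    Timed.tick
    let x ← Timed.load q i
    let u ← Timed.load (s (Sum.inl i)) x
    let v ← Timed.load (s (Sum.inr i)) x
    let uv ← Timed.add u v
    let wi ← Timed.load w i
    let c ← Timed.mul wi uv
    let acc₂ ← Timed.add acc c
    projLoop s w q is acc₂

/-- The hash bit of the query for one direction, given by its block sums. -/
def queryBit {d M : ℕ} (s : Fin d ⊕ Fin d → Fin (M + 1) → ℝ) (w : Fin d → ℝ) (q : Point d M) :
    Timed ℕ := do
  let p ← projLoop s w q (List.finRange d) 0
  let neg ← Timed.less p 0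
  if neg then pure 0 else pure 1

/-- Pack the hash bits of the query for the listed directions on top of `acc`. -/
def keyLoop {d M k n : ℕ} (T : Table d M k n) (w : Fin d → ℝ) (q : Point d M) :
    List (Fin k) → ℕ → Timed ℕ
  | [], acc => pure acc
  | j :: js, acc => do
    Timed.tick
    let b ← queryBit (T.sums j) w q
    let twice ← Timed.add acc acc
    let acc₂ ← Timed.add twice b
    keyLoop T w q js acc₂

/-- The key of the query in one table; the last bit is the most significant one. -/
def queryKey {d M k n : ℕ} (T : Table d M k n) (w : Fin d → ℝ) (q : Point d M) : Timed ℕ :=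
  keyLoop T w q (List.finRange k).reverse 0

/-- Binary search in a sorted array for the first position in `[lo, hi)` whose key is at
least `κ` (the answer is `hi` if there is none). The first argument only bounds the number of
rounds; every value that is at least `hi - lo` gives the same result at the same cost. -/
def search {n : ℕ} (key : Fin n → ℕ) (κ : ℕ) : ℕ → ℕ → ℕ → Timed ℕ
  | 0, lo, _ => pure lo
  | fuel + 1, lo, hi => do
    let continues ← Timed.less lo hi
    if continues then
      let sum ← Timed.add lo hi
      let mid ← Timed.half sum
      if h : mid < n then
        let x ← Timed.load key ⟨mid, h⟩
        let smaller ← Timed.less x κ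
        if smaller then
          let lo₂ ← Timed.add mid 1
          search key κ fuel lo₂ hi
        else
          search key κ fuel lo mid
      else
        pure lo
    else
      pure lo

/-- Add the contributions of the coordinates in the list to the weighted distance. -/
def distLoop {d M : ℕ} (w : Fin d → ℝ) (o q : Point d M) : List (Fin d) → ℝ → Timed ℝ
  | [], acc => pure acc
  | i :: is, acc => do
    Timed.tick
    let x ← Timed.load o i
    let y ← Timed.load q i
    let wi ← Timed.load w i
    let z ← Timed.sub ((x : ℕ) : ℝ) ((y : ℕ) : ℝ)
    let e ← Timed.abs z
    let c ← Timed.mul wi e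
    let acc₂ ← Timed.add acc c
    distLoop w o q is acc₂

/-- Examine the data points of the bucket with key `κ`, from position `pos` on, until one at
distance at most `R₂` is found, the bucket ends, or the budget (the first argument) is used up.
The result is the point found, if any, and the remaining budget. -/
def scan {d M k L n : ℕ} (S : Index d M k L n) (T : Table d M k n) (w : Fin d → ℝ) (q : Point d M)
    (R₂ : ℝ) (κ : ℕ) : ℕ → ℕ → Timed (Option (Fin n) × ℕ)
  | 0, _ => do
    Timed.tick
    pure (none, 0)
  | budget + 1, pos => do
    Timed.tick
    let _inRange ← Timed.less pos n
    if h : pos < n then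
      let x ← Timed.load T.key ⟨pos, h⟩
      let same ← Timed.equal x κ
      if same then
        let m ← Timed.load T.id ⟨pos, h⟩
        let o ← Timed.load S.data m
        let r ← distLoop w o q (List.finRange d) 0
        let tooFar ← Timed.less R₂ r
        if tooFar then
          let pos₂ ← Timed.add pos 1
          scan S T w q R₂ κ budget pos₂
        else
          pure (some m, budget)
      else
        pure (none, budget + 1)
    else
      pure (none, budget + 1)

/-- Visit the listed tables one after the other, with a common budget of data points that may be
examined, until a point at distance at most `R₂` is found. -/
def tableLoop {d M k L n : ℕ} (S : Index d M k L n) (w : Fin d → ℝ) (q : Point d M) (R₂ : ℝ) :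
    List (Fin L) → ℕ → Timed (Option (Fin n))
  | [], _ => pure none
  | t :: ts, budget => do
    Timed.tick
    let κ ← queryKey (S.tables t) w q
    let pos ← search (S.tables t).key κ n 0 n
    let res ← scan S (S.tables t) w q R₂ κ budget pos
    Timed.tick
    match res with
    | (some m, _) => pure (some m)
    | (none, rest) => tableLoop S w q R₂ ts rest

/-- The query algorithm. At most `cap` data points are examined. -/
def query {d M k L n : ℕ} (cap : ℕ) (S : Index d M k L n) (w : Fin d → ℝ) (q : Point d M)
    (R₂ : ℝ) : Timed (Option (Fin n)) :=
  tableLoop S w q R₂ (List.finRange L) cap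

/-- `ans` is a correct answer to the near neighbor problem with thresholds `R₁ < R₂` for
the data set `D` and the query `q` with weights `w`: if some data point is at distance at
most `R₁`, the answer is a data point at distance at most `R₂`. -/
def IsCorrectAnswer {d M n : ℕ} (w : Fin d → ℝ) (R₁ R₂ : ℝ) (D : Fin n → Point d M)
    (q : Point d M) (ans : Option (Fin n)) : Prop :=
  (∃ i, wdist w (D i) q ≤ R₁) → ∃ m, ans = some m ∧ wdist w (D m) q ≤ R₂

end ThetaALSH

end

namespace ThetaALSH

/-! ### Sign agreement of two Gaussian projections -/

/-! The transformed data and query points have squared norms `d * M` and `M * ∑ i, w i ^ 2`,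
whatever the points are. Because unary digits are 0 or 1, their inner product is `M * ∑ i, w i`
minus the weighted distance. The angle between them is thus a function of the distance alone. Signs
of two Gaussian projections agree with probability `1 - θ / π`: their joint law depends only on the
Gram matrix (`map_pair_pi_gaussian_eq`), so the question moves to the plane, where a cone has
measure proportional to its angle (`gaussian_prod_cone`). This gives
`directionLaw_hashData_eq_hashQuery`; strict monotonicity (`collisionProb_lt`) gives `ρ < 1`.

The rest is amplification. About `log n / -log P₂` bits per table make a far point collide with
probability at most `1 / n`, so the `L` tables produce at most `L` far collisions on average, while
a near point collides in a given table with probability at least `P₁ / n ^ ρ`. With order `n ^ ρ`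
tables a near point is missed everywhere with probability at most `δ / 2`, and by Markov the far
collisions exhaust a budget of order `L / δ` with probability at most `δ / 2` (`failure_bound`).
Outside these two events the algorithm succeeds deterministically (`isCorrectAnswer_query`).

For the running time, block sums make a query bit cost `O(d)` instead of `O(dM)`
(`blockSums_add_eq`), and one budget shared by all tables pays for all distance computations
(`tableLoop_steps`). -/

theorem pos_mul_neg_iff {a b : ℝ} (ha : 0 < a) : a * b < 0 ↔ b < 0 := by
  simpa using mul_lt_mul_iff_right₀ (b := b) (c := 0) ha

/-- A functional of the pair of projections is itself one projection, on a combination of `x` and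
`y`. Its Gaussian characteristic function sees only the norm of that combination, a quadratic form
in the Gram matrix. -/
theorem charFunDual_map_pair_pi_gaussian {ι : Type*} [Fintype ι] (x y : ι → ℝ)
    (l : StrongDual ℝ (ℝ × ℝ)) :
    charFunDual ((Measure.pi fun _ : ι => gaussianReal 0 1).map
      fun a => (∑ c, a c * x c, ∑ c, a c * y c)) l =
      Complex.exp (-((l (1, 0) ^ 2 * ∑ c, x c ^ 2 + 2 * l (1, 0) * l (0, 1) * ∑ c, x c * y c +
        l (0, 1) ^ 2 * ∑ c, y c ^ 2 : ℝ) : ℂ) / 2) := by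
  have hl : ∀ a b : ℝ, l (a, b) = a * l (1, 0) + b * l (0, 1) := by
    intro a b
    have : ((a, b) : ℝ × ℝ) = a • (1, 0) + b • (0, 1) := by simp
    rw [this, map_add, map_smul, map_smul, smul_eq_mul, smul_eq_mul]
  set p := l (1, 0)
  set q := l (0, 1)
  have key := charFun_stdGaussian (E := EuclideanSpace ℝ ι)
    (WithLp.toLp 2 fun c => p * x c + q * y c)
  rw [charFun_apply, ← map_pi_eq_stdGaussian,
    integral_map (by fun_prop) (Measurable.aestronglyMeasurable (by fun_prop))] at key
  rw [charFunDual_apply, integral_map (Measurable.aemeasurable (by fun_prop))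
    (Measurable.aestronglyMeasurable (by fun_prop))]
  have hnorm : ‖(WithLp.toLp 2 fun c => p * x c + q * y c : EuclideanSpace ℝ ι)‖ ^ 2 =
      p ^ 2 * ∑ c, x c ^ 2 + 2 * p * q * ∑ c, x c * y c + q ^ 2 * ∑ c, y c ^ 2 := by
    rw [EuclideanSpace.norm_sq_eq]
    simp only [Real.norm_eq_abs, sq_abs, Finset.mul_sum, ← Finset.sum_add_distrib]
    exact Finset.sum_congr rfl fun c _ => by ring
  rw [← hnorm, Complex.ofReal_pow, ← key]
  congr 1
  funext a
  rw [hl, PiLp.inner_apply, Finset.sum_mul, Finset.sum_mul, ← Finset.sum_add_distrib]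
  congr 4
  funext c
  simp only [RCLike.inner_apply, conj_trivial]
  ring

/-- The joint law of two projections of a standard Gaussian vector depends only on the
Gram matrix of the two directions. -/
theorem map_pair_pi_gaussian_eq {ι κ : Type*} [Fintype ι] [Fintype κ] {x y : ι → ℝ} {x' y' : κ → ℝ}
    (hx : ∑ c, x c ^ 2 = ∑ c, x' c ^ 2) (hxy : ∑ c, x c * y c = ∑ c, x' c * y' c)
    (hy : ∑ c, y c ^ 2 = ∑ c, y' c ^ 2) :
    ((Measure.pi fun _ : ι => gaussianReal 0 1).map
      fun a => (∑ c, a c * x c, ∑ c, a c * y c)) =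
    ((Measure.pi fun _ : κ => gaussianReal 0 1).map
      fun a => (∑ c, a c * x' c, ∑ c, a c * y' c)) := by
  have := Measure.isProbabilityMeasure_map (μ := Measure.pi fun _ : ι => gaussianReal 0 1)
    (f := fun a => (∑ c, a c * x c, ∑ c, a c * y c)) (Measurable.aemeasurable (by fun_prop))
  have := Measure.isProbabilityMeasure_map (μ := Measure.pi fun _ : κ => gaussianReal 0 1)
    (f := fun a => (∑ c, a c * x' c, ∑ c, a c * y' c)) (Measurable.aemeasurable (by fun_prop))
  refine Measure.ext_of_charFunDual ?_
  ext l
  rw [charFunDual_map_pair_pi_gaussian, charFunDual_map_pair_pi_gaussian, hx, hxy, hy]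

open Set in
/-- The standard Gaussian measure of a cone in the plane is proportional to its angle. -/
theorem gaussian_prod_cone {A : Set (ℝ × ℝ)} (hA : MeasurableSet A) {B : Set ℝ}
    (hB : MeasurableSet B)
    (hAB : ∀ r φ : ℝ, 0 < r → ((r * Real.cos φ, r * Real.sin φ) ∈ A ↔ φ ∈ B)) :
    ((gaussianReal 0 1).prod (gaussianReal 0 1)) A =
      (∫⁻ r in Ioi (0 : ℝ), ENNReal.ofReal r *
        ENNReal.ofReal ((2 * Real.pi)⁻¹ * Real.exp (-r ^ 2 / 2))) *
      volume (B ∩ Ioo (-Real.pi) Real.pi) := by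
  -- Rotation invariance: the planar density depends on `r` only, so in polar coordinates the
  -- integral factors.
  have hpdf : ∀ r φ : ℝ, gaussianPDF 0 1 (r * Real.cos φ) * gaussianPDF 0 1 (r * Real.sin φ) =
      ENNReal.ofReal ((2 * Real.pi)⁻¹ * Real.exp (-r ^ 2 / 2)) := by
    intro r φ
    rw [gaussianPDF_def, ← ENNReal.ofReal_mul (gaussianPDFReal_nonneg _ _ _)]
    congr 1
    simp only [gaussianPDFReal, NNReal.coe_one, mul_one, sub_zero]
    rw [mul_mul_mul_comm, ← mul_inv, Real.mul_self_sqrt (by positivity), ← Real.exp_add]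
    congr 2
    have := Real.sin_sq_add_cos_sq φ
    linear_combination (-r ^ 2 / 2) * this
  have hm : Measurable fun r : ℝ => ENNReal.ofReal r *
      ENNReal.ofReal ((2 * Real.pi)⁻¹ * Real.exp (-r ^ 2 / 2)) := by fun_prop
  rw [gaussianReal_of_var_ne_zero 0 one_ne_zero,
    prod_withDensity (measurable_gaussianPDF 0 1) (measurable_gaussianPDF 0 1),
    withDensity_apply _ hA, ← lintegral_indicator hA, ← Measure.volume_eq_prod,
    ← lintegral_comp_polarCoord_symm, polarCoord_target, Measure.volume_eq_prod,
    ← Measure.prod_restrict]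
  have hBI : volume (B ∩ Ioo (-Real.pi) Real.pi) =
      ∫⁻ φ in Ioo (-Real.pi) Real.pi, B.indicator 1 φ := by
    rw [lintegral_indicator_one hB, Measure.restrict_apply hB]
  rw [hBI, ← lintegral_prod_mul hm.aemeasurable
    ((measurable_one.indicator hB).aemeasurable), Measure.prod_restrict]
  refine setLIntegral_congr_fun (measurableSet_Ioi.prod measurableSet_Ioo) ?_
  rintro ⟨r, φ⟩ ⟨hr, -⟩
  simp only [polarCoord_symm_apply, smul_eq_mul, mul_assoc]
  congr 1
  by_cases hφ : φ ∈ B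
  · rw [indicator_of_mem ((hAB r φ hr).2 hφ), indicator_of_mem hφ, hpdf]
    simp
  · rw [indicator_of_notMem (fun h => hφ ((hAB r φ hr).1 h)), indicator_of_notMem hφ, mul_zero]

/-- The interval is the one that contains both `φ` and `φ - θ` when `φ` is in `(-π, π)` and `θ` in
`[0, π]`. -/
theorem cos_neg_iff {ψ : ℝ} (h1 : -(2 * Real.pi) < ψ) (h2 : ψ < Real.pi) :
    Real.cos ψ < 0 ↔ Real.pi / 2 < ψ ∨ -(3 * Real.pi / 2) < ψ ∧ ψ < -(Real.pi / 2) := by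
  have hπ := Real.pi_pos
  constructor
  · intro h
    by_contra! hc
    rcases le_or_gt ψ (-(3 * Real.pi / 2)) with h3 | h3
    · rw [← Real.cos_add_two_pi] at h
      exact h.not_ge (Real.cos_nonneg_of_neg_pi_div_two_le_of_le (by linarith) (by linarith))
    · exact h.not_ge (Real.cos_nonneg_of_neg_pi_div_two_le_of_le (hc.2 h3) hc.1)
  · rintro (h | ⟨h, h'⟩)
    · exact Real.cos_neg_of_pi_div_two_lt_of_lt h (by linarith)
    · rw [← Real.cos_neg]
      exact Real.cos_neg_of_pi_div_two_lt_of_lt (by linarith) (by linarith)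

open Set in
-- On the circle, two half-planes at angle `θ` differ in two opposite arcs of length `θ`. The case
-- split comes from cutting the circle at `±π`.
theorem volume_sign_disagreement {θ : ℝ} (h0 : 0 ≤ θ) (hπ : θ ≤ Real.pi) :
    volume ({φ : ℝ | ¬(Real.cos φ < 0 ↔ Real.cos (φ - θ) < 0)} ∩ Ioo (-Real.pi) Real.pi) =
      ENNReal.ofReal (2 * θ) := by
  have hpi := Real.pi_pos
  set p := Real.pi
  have hmem : ∀ φ, φ ∈ {φ : ℝ | ¬(Real.cos φ < 0 ↔ Real.cos (φ - θ) < 0)} ∩ Ioo (-p) p ↔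
      (-p < φ ∧ φ < p) ∧ ¬((p / 2 < φ ∨ -(3 * p / 2) < φ ∧ φ < -(p / 2)) ↔
        (p / 2 < φ - θ ∨ -(3 * p / 2) < φ - θ ∧ φ - θ < -(p / 2))) := by
    intro φ
    rw [mem_inter_iff, and_comm]
    refine and_congr_right fun h => ?_
    rw [mem_ofPred_eq, cos_neg_iff (by linarith [h.1]) h.2,
      cos_neg_iff (by linarith [h.1]) (by linarith [h.2])]
  -- For opposite directions the signs differ except where both cosines vanish, at two points.
  rcases hπ.eq_or_lt with h | hπ
  · have hset : {φ : ℝ | ¬(Real.cos φ < 0 ↔ Real.cos (φ - θ) < 0)} ∩ Ioo (-p) p =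
        Ioo (-p) p \ {-(p / 2), p / 2} := by
      ext φ
      rw [hmem, mem_sdiff, mem_Ioo, mem_insert_iff, mem_singleton_iff]
      clear hmem
      clear_value p
      grind
    rw [hset, measure_sdiff_null (Set.Finite.measure_zero (by simp) _), Real.volume_Ioo]
    congr 1; linarith
  rcases lt_or_ge θ (p / 2) with h | h
  · have hset : {φ : ℝ | ¬(Real.cos φ < 0 ↔ Real.cos (φ - θ) < 0)} ∩ Ioo (-p) p =
        Ico (-(p / 2)) (θ - p / 2) ∪ Ioc (p / 2) (θ + p / 2) := by
      ext φ
      rw [hmem, mem_union, mem_Ico, mem_Ioc]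
      clear hmem
      grind
    rw [hset, measure_union (by
        rw [Set.disjoint_left]; intro x; simp only [mem_Ico, mem_Ioc]; grind)
      measurableSet_Ioc, Real.volume_Ico, Real.volume_Ioc,
      ← ENNReal.ofReal_add (by linarith) (by linarith)]
    congr 1; ring
  -- Now the arc that starts at `p / 2` reaches the cut and continues from `-p`, which gives a third
  -- piece.
  · have hset : {φ : ℝ | ¬(Real.cos φ < 0 ↔ Real.cos (φ - θ) < 0)} ∩ Ioo (-p) p =
        (Ico (-(p / 2)) (θ - p / 2) ∪ Ioo (p / 2) p) ∪ Ioc (-p) (θ - 3 * p / 2) := by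
      ext φ
      rw [hmem, mem_union, mem_union, mem_Ico, mem_Ioc, mem_Ioo]
      clear hmem
      clear_value p
      constructor
      · rintro ⟨⟨h1, h2⟩, h3⟩
        by_contra! h4
        grind
      · rintro ((⟨h1, h2⟩ | ⟨h1, h2⟩) | ⟨h1, h2⟩) <;>
          refine ⟨⟨by linarith, by linarith⟩, ?_⟩ <;> grind
    rw [hset, measure_union (by
        rw [Set.disjoint_left]; intro x; simp only [mem_union, mem_Ico, mem_Ioc, mem_Ioo]; grind)
      measurableSet_Ioc, measure_union (by
        rw [Set.disjoint_left]; intro x; simp only [mem_Ico, mem_Ioo]; grind)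
      measurableSet_Ioo, Real.volume_Ico, Real.volume_Ioc, Real.volume_Ioo,
      ← ENNReal.ofReal_add (by linarith) (by linarith),
      ← ENNReal.ofReal_add (by linarith) (by linarith)]
    congr 1; ring

/-- For a standard Gaussian vector in the plane, the signs of the projections on two unit vectors
at angle `θ` agree with probability `1 - θ / π`. -/
theorem gaussian_prod_sign_agreement {θ : ℝ} (h0 : 0 ≤ θ) (hπ : θ ≤ Real.pi) :
    ((gaussianReal 0 1).prod (gaussianReal 0 1)).real
      {z | z.1 < 0 ↔ Real.cos θ * z.1 + Real.sin θ * z.2 < 0} = 1 - 1 / Real.pi * θ := by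
  have hA : MeasurableSet {z : ℝ × ℝ | ¬(z.1 < 0 ↔ Real.cos θ * z.1 + Real.sin θ * z.2 < 0)} := by
    have h1 : MeasurableSet {z : ℝ × ℝ | z.1 < 0} := measurableSet_lt (by fun_prop) (by fun_prop)
    have h2 : MeasurableSet {z : ℝ × ℝ | Real.cos θ * z.1 + Real.sin θ * z.2 < 0} :=
      measurableSet_lt (by fun_prop) (by fun_prop)
    exact (h1.iff h2).compl
  have hB : MeasurableSet {φ : ℝ | ¬(Real.cos φ < 0 ↔ Real.cos (φ - θ) < 0)} := by
    have h1 : MeasurableSet {φ : ℝ | Real.cos φ < 0} :=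
      measurableSet_lt (by fun_prop) (by fun_prop)
    have h2 : MeasurableSet {φ : ℝ | Real.cos (φ - θ) < 0} :=
      measurableSet_lt (by fun_prop) (by fun_prop)
    exact (h1.iff h2).compl
  -- The whole plane, seen as a cone, normalizes the radial factor: its value is never computed.
  have htot := gaussian_prod_cone MeasurableSet.univ MeasurableSet.univ
    (fun r φ _ => by simp : ∀ r φ : ℝ, 0 < r →
      ((r * Real.cos φ, r * Real.sin φ) ∈ (Set.univ : Set (ℝ × ℝ)) ↔ φ ∈ (Set.univ : Set ℝ)))
  have hdis := gaussian_prod_cone hA hB (by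
    intro r φ hr
    have h2 : Real.cos θ * (r * Real.cos φ) + Real.sin θ * (r * Real.sin φ) =
        r * Real.cos (φ - θ) := by rw [Real.cos_sub]; ring
    simp only [Set.mem_ofPred_eq, h2, pos_mul_neg_iff hr])
  rw [volume_sign_disagreement h0 hπ] at hdis
  rw [Set.univ_inter, Real.volume_Ioo, measure_univ] at htot
  generalize (∫⁻ r in Set.Ioi (0 : ℝ), ENNReal.ofReal r *
        ENNReal.ofReal ((2 * Real.pi)⁻¹ * Real.exp (-r ^ 2 / 2))) = K at htot hdis
  have htot' := congrArg ENNReal.toReal htot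
  have hdis' := congrArg ENNReal.toReal hdis
  rw [ENNReal.toReal_mul, ENNReal.toReal_ofReal (by linarith [Real.pi_pos])] at htot'
  rw [ENNReal.toReal_mul, ENNReal.toReal_ofReal (by linarith)] at hdis'
  have hcompl := probReal_compl_eq_one_sub (μ := (gaussianReal 0 1).prod (gaussianReal 0 1)) hA
  rw [show {z : ℝ × ℝ | ¬(z.1 < 0 ↔ Real.cos θ * z.1 + Real.sin θ * z.2 < 0)}ᶜ =
    {z | z.1 < 0 ↔ Real.cos θ * z.1 + Real.sin θ * z.2 < 0} from
      Set.ext fun z => not_not] at hcompl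
  rw [hcompl, Measure.real, hdis']
  simp only [ENNReal.toReal_one] at htot'
  field_simp
  linear_combination θ * htot'

/-- Only the Gram matrix matters, so `x` and `y` may be replaced by plane vectors with the same
lengths and angle; the lengths do not affect signs. -/
theorem pi_gaussian_sign_agreement {ι : Type*} [Fintype ι] {x y : ι → ℝ}
    (hx : 0 < ∑ c, x c ^ 2) (hy : 0 < ∑ c, y c ^ 2) :
    (Measure.pi fun _ : ι => gaussianReal 0 1).real
      {a | ∑ c, a c * x c < 0 ↔ ∑ c, a c * y c < 0} =
    1 - 1 / Real.pi * Real.arccos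
      ((∑ c, x c * y c) / (√(∑ c, x c ^ 2) * √(∑ c, y c ^ 2))) := by
  set X := ∑ c, x c ^ 2
  set Y := ∑ c, y c ^ 2
  have hX := Real.sqrt_pos.2 hx
  have hY := Real.sqrt_pos.2 hy
  -- Cauchy–Schwarz puts the quotient in `[-1, 1]`, where `cos` inverts `arccos`.
  have hcs : |∑ c, x c * y c| ≤ √X * √Y := by
    rw [← Real.sqrt_mul hx.le]
    exact Real.abs_le_sqrt (Finset.sum_mul_sq_le_sq_mul_sq _ _ _)
  set θ := Real.arccos ((∑ c, x c * y c) / (√X * √Y)) with hθ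
  have hcos : Real.cos θ = (∑ c, x c * y c) / (√X * √Y) := by
    have := abs_le.1 hcs
    apply Real.cos_arccos
    · rw [le_div_iff₀ (by positivity)]; linarith
    · rw [div_le_one (by positivity)]; linarith
  rw [← gaussian_prod_sign_agreement (Real.arccos_nonneg _) (Real.arccos_le_pi _)]
  have hlaw := map_pair_pi_gaussian_eq (x := x) (y := y) (x' := ![√X, 0])
    (y' := ![√Y * Real.cos θ, √Y * Real.sin θ])
    (by simp [Real.sq_sqrt hx.le, X]) (by simp [hcos]; field_simp)
    (by
      simp only [Fin.sum_univ_two, Matrix.cons_val_zero, Matrix.cons_val_one, mul_pow,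
        Real.sq_sqrt hy.le]
      rw [← mul_add, Real.cos_sq_add_sin_sq, mul_one])
  have hS : MeasurableSet {z : ℝ × ℝ | z.1 < 0 ↔ z.2 < 0} := by
    have h1 : MeasurableSet {z : ℝ × ℝ | z.1 < 0} := measurableSet_lt (by fun_prop) (by fun_prop)
    have h2 : MeasurableSet {z : ℝ × ℝ | z.2 < 0} := measurableSet_lt (by fun_prop) (by fun_prop)
    exact h1.iff h2
  have hev := congrArg (fun ν : Measure (ℝ × ℝ) => ν.real {z | z.1 < 0 ↔ z.2 < 0}) hlaw
  rw [map_measureReal_apply (by fun_prop) hS, map_measureReal_apply (by fun_prop) hS] at hev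
  refine hev.trans ?_
  have hA : MeasurableSet {z : ℝ × ℝ | z.1 < 0 ↔ Real.cos θ * z.1 + Real.sin θ * z.2 < 0} := by
    have h1 : MeasurableSet {z : ℝ × ℝ | z.1 < 0} := measurableSet_lt (by fun_prop) (by fun_prop)
    have h2 : MeasurableSet {z : ℝ × ℝ | Real.cos θ * z.1 + Real.sin θ * z.2 < 0} :=
      measurableSet_lt (by fun_prop) (by fun_prop)
    exact h1.iff h2
  rw [← (measurePreserving_finTwoArrow (gaussianReal 0 1)).measureReal_preimage
    hA.nullMeasurableSet]
  congr 1
  ext a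
  have e1 : √X * a 0 < 0 ↔ a 0 < 0 := pos_mul_neg_iff hX
  have e2 : a 0 * (√Y * Real.cos θ) + a 1 * (√Y * Real.sin θ) =
    √Y * (Real.cos θ * a 0 + Real.sin θ * a 1) := by ring
  simp [Fin.sum_univ_two, mul_comm (a 0) √X, e1, e2, pos_mul_neg_iff hY,
    MeasurableEquiv.finTwoArrow]

/-! ### The collision probability -/

theorem unary_eq_zero_or_one {M : ℕ} (x : Fin (M + 1)) (j : Fin M) :
    unary x j = 0 ∨ unary x j = 1 := by
  unfold unary
  split_ifs <;> simp

theorem unary_mono {M : ℕ} {x y : Fin (M + 1)} (h : x ≤ y) (j : Fin M) :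
    unary x j ≤ unary y j := by
  have : (x : ℕ) ≤ y := h
  unfold unary
  split_ifs <;> first | omega | norm_num

theorem sum_unary {M : ℕ} (x : Fin (M + 1)) : ∑ j, unary x j = (x : ℕ) := by
  unfold unary
  rw [Finset.sum_boole, Fin.card_filter_val_lt]
  congr 1
  omega

/-- The left side is the cosine of a difference of angles that are 0 or `π / 2`, so it indicates
equality of the digits. -/
theorem cos_mul_cos_add_sin_mul_sin_unary {M : ℕ} (x y : Fin (M + 1)) (j : Fin M) :
    Real.cos (Real.pi / 2 * unary x j) * Real.cos (Real.pi / 2 * unary y j) +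
      Real.sin (Real.pi / 2 * unary x j) * Real.sin (Real.pi / 2 * unary y j) =
    1 - |unary x j - unary y j| := by
  rcases unary_eq_zero_or_one x j with hx | hx <;> rcases unary_eq_zero_or_one y j with hy | hy <;>
    simp [hx, hy]

/-- Unary codes are nested: all digit differences have the same sign, so the absolute values
telescope into one. -/
theorem sum_abs_unary_sub {M : ℕ} (x y : Fin (M + 1)) :
    ∑ j, |unary x j - unary y j| = |((x : ℕ) : ℝ) - ((y : ℕ) : ℝ)| := by
  wlog h : x ≤ y generalizing x y
  · rw [abs_sub_comm, ← this y x (le_of_not_ge h)]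
    exact Finset.sum_congr rfl fun j _ => abs_sub_comm _ _
  have h' : ((x : ℕ) : ℝ) ≤ (y : ℕ) := Nat.cast_le.2 h
  rw [abs_of_nonpos (sub_nonpos.2 h'), ← sum_unary, ← sum_unary, ← Finset.sum_sub_distrib,
    ← Finset.sum_neg_distrib]
  exact Finset.sum_congr rfl fun j _ => abs_of_nonpos (sub_nonpos.2 (unary_mono h j))

theorem sum_coord {d M : ℕ} (f : Coord d M → ℝ) :
    ∑ c, f c = ∑ i, ∑ j, (f (Sum.inl (i, j)) + f (Sum.inr (i, j))) := by
  rw [Fintype.sum_sum_type, Fintype.sum_prod_type, Fintype.sum_prod_type, ← Finset.sum_add_distrib]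
  exact Finset.sum_congr rfl fun i _ => Finset.sum_add_distrib.symm

theorem sum_preTrans_mul_queryTrans {d M : ℕ} (w : Fin d → ℝ) (o q : Point d M) :
    ∑ c, preTrans o c * queryTrans w q c = M * ∑ i, w i - wdist w o q := by
  rw [sum_coord, wdist, Finset.mul_sum, ← Finset.sum_sub_distrib]
  refine Finset.sum_congr rfl fun i _ => ?_
  have : ∀ j, preTrans o (Sum.inl (i, j)) * queryTrans w q (Sum.inl (i, j)) +
      preTrans o (Sum.inr (i, j)) * queryTrans w q (Sum.inr (i, j)) =
      w i * (1 - |unary (o i) j - unary (q i) j|) := by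
    intro j
    rw [← cos_mul_cos_add_sin_mul_sin_unary]
    simp only [preTrans, queryTrans]
    ring
  simp only [this, ← Finset.mul_sum, Finset.sum_sub_distrib, sum_abs_unary_sub]
  simp
  ring

theorem sum_preTrans_sq {d M : ℕ} (o : Point d M) : ∑ c, preTrans o c ^ 2 = d * M := by
  rw [sum_coord]
  simp [preTrans]

theorem sum_queryTrans_sq {d M : ℕ} (w : Fin d → ℝ) (q : Point d M) :
    ∑ c, queryTrans w q c ^ 2 = M * ∑ i, w i ^ 2 := by
  rw [sum_coord]
  simp [queryTrans, mul_pow, ← mul_add, Finset.mul_sum]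

theorem angularHash_eq_iff {ι : Type} [Fintype ι] (a x y : ι → ℝ) :
    angularHash a x = angularHash a y ↔ (∑ c, a c * x c < 0 ↔ ∑ c, a c * y c < 0) := by
  unfold angularHash
  split_ifs with h1 h2 h2 <;> simp [h1, h2]

theorem sum_sq_pos {d : ℕ} {w : Fin d → ℝ} (hw : w ≠ 0) : 0 < ∑ i, w i ^ 2 := by
  obtain ⟨i, hi⟩ := Function.ne_iff.1 hw
  exact Finset.sum_pos' (fun _ _ => sq_nonneg _) ⟨i, Finset.mem_univ i, sq_pos_of_ne_zero hi⟩

theorem directionLaw_hashData_eq_hashQuery {d M : ℕ} (hd : 0 < d) (hM : 0 < M) {w : Fin d → ℝ}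
    (hw : w ≠ 0) (o q : Point d M) :
    (directionLaw d M).real {a | hashData a o = hashQuery a w q} =
      collisionProb M w (wdist w o q) := by
  have hd' : (0 : ℝ) < d := Nat.cast_pos.2 hd
  have hM' : (0 : ℝ) < M := Nat.cast_pos.2 hM
  have hw' := sum_sq_pos hw
  have h := pi_gaussian_sign_agreement (x := preTrans o) (y := queryTrans w q)
    (by rw [sum_preTrans_sq]; positivity) (by rw [sum_queryTrans_sq]; positivity)
  rw [sum_preTrans_mul_queryTrans, sum_preTrans_sq, sum_queryTrans_sq,
    ← Real.sqrt_mul (by positivity)] at h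
  have hsqrt : √((d : ℝ) * M * (M * ∑ i, w i ^ 2)) = M * √(d * ∑ i, w i ^ 2) := by
    rw [show (d : ℝ) * M * (M * ∑ i, w i ^ 2) = M ^ 2 * (d * ∑ i, w i ^ 2) by ring,
      Real.sqrt_mul (by positivity), Real.sqrt_sq hM'.le]
  rw [hsqrt] at h
  simp only [hashData, hashQuery, angularHash_eq_iff]
  exact h

theorem cosAngle_anti {d M : ℕ} (w : Fin d → ℝ) {r s : ℝ} (h : r ≤ s) :
    cosAngle M w s ≤ cosAngle M w r := by
  unfold cosAngle
  gcongr

theorem cosAngle_strictAnti {d M : ℕ} (hd : 0 < d) (hM : 0 < M) {w : Fin d → ℝ} (hw : w ≠ 0)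
    {r s : ℝ} (h : r < s) : cosAngle M w s < cosAngle M w r := by
  have hw' := sum_sq_pos hw
  have hd' : (0 : ℝ) < d := Nat.cast_pos.2 hd
  have hM' : (0 : ℝ) < M := Nat.cast_pos.2 hM
  unfold cosAngle
  gcongr

theorem collisionProb_anti {d M : ℕ} (w : Fin d → ℝ) {r s : ℝ} (h : r ≤ s) :
    collisionProb M w s ≤ collisionProb M w r := by
  have := Real.arccos_le_arccos (cosAngle_anti (M := M) w h)
  have hpi := Real.pi_pos
  unfold collisionProb
  gcongr

theorem collisionProb_le_one {d M : ℕ} (w : Fin d → ℝ) (r : ℝ) : collisionProb M w r ≤ 1 := by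
  have := Real.arccos_nonneg (cosAngle M w r)
  have hpi := Real.pi_pos
  unfold collisionProb
  have : 0 ≤ 1 / Real.pi * Real.arccos (cosAngle M w r) := by positivity
  linarith

theorem collisionProb_pos {d M : ℕ} {w : Fin d → ℝ} {r : ℝ} (h : -1 < cosAngle M w r) :
    0 < collisionProb M w r := by
  have hpi := Real.pi_pos
  have : Real.arccos (cosAngle M w r) < Real.pi := by
    refine lt_of_le_of_ne (Real.arccos_le_pi _) fun hc => ?_
    exact absurd (Real.arccos_eq_pi.1 hc) (not_le.2 h)
  unfold collisionProb
  rw [one_div, inv_mul_eq_div, sub_pos, div_lt_one hpi]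
  exact this

/-- The two one-sided bounds suffice: by monotonicity they place both cosines in `[-1, 1]`, where
`arccos` is strictly decreasing. -/
theorem collisionProb_lt {d M : ℕ} (hd : 0 < d) (hM : 0 < M) {w : Fin d → ℝ} (hw : w ≠ 0)
    {R₁ R₂ : ℝ} (hR : R₁ < R₂) (h1 : cosAngle M w R₁ ≤ 1) (h2 : -1 < cosAngle M w R₂) :
    collisionProb M w R₂ < collisionProb M w R₁ := by
  have hlt := cosAngle_strictAnti hd hM hw hR
  have hpi := Real.pi_pos
  have := Real.strictAntiOn_arccos ⟨h2.le, hlt.le.trans h1⟩ ⟨(h2.trans hlt).le, h1⟩ hlt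
  unfold collisionProb
  gcongr

/-! ### Hash keys -/

namespace Timed

@[simp] theorem val_pure {α : Type} (a : α) : (pure a : Timed α).val = a := rfl

@[simp] theorem steps_pure {α : Type} (a : α) : (pure a : Timed α).steps = 0 := rfl

@[simp] theorem val_bind {α β : Type} (x : Timed α) (f : α → Timed β) :
    (x >>= f).val = (f x.val).val := rfl

@[simp] theorem steps_bind {α β : Type} (x : Timed α) (f : α → Timed β) :
    (x >>= f).steps = x.steps + (f x.val).steps := rfl

end Timed

/-- In each block the cosines are 1 exactly on the digits `j ≥ q i` and the sines exactly on `j < q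
i`, so a block of `2M` products collapses to two stored sums. -/
theorem blockSums_add_eq {d M : ℕ} (a : Coord d M → ℝ) (w : Fin d → ℝ) (q : Point d M) (i : Fin d) :
    w i * (blockSums a (Sum.inl i) (q i) + blockSums a (Sum.inr i) (q i)) =
      ∑ j, (a (Sum.inl (i, j)) * queryTrans w q (Sum.inl (i, j)) +
        a (Sum.inr (i, j)) * queryTrans w q (Sum.inr (i, j))) := by
  simp only [blockSums, queryTrans, ← Finset.sum_add_distrib, Finset.mul_sum]
  refine Finset.sum_congr rfl fun j _ => ?_
  unfold unary
  by_cases h : (j : ℕ) < (q i : ℕ)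
  · simp [h, not_le.2 h, mul_comm]
  · simp [h, not_lt.1 h, mul_comm]

theorem projLoop_val {d M : ℕ} (s : Fin d ⊕ Fin d → Fin (M + 1) → ℝ) (w : Fin d → ℝ)
    (q : Point d M) (l : List (Fin d)) (acc : ℝ) :
    (projLoop s w q l acc).val =
      acc + (l.map fun i => w i * (s (Sum.inl i) (q i) + s (Sum.inr i) (q i))).sum := by
  induction l generalizing acc with
  | nil => simp [projLoop]
  | cons i l ih => simp [projLoop, ih, Timed.load, Timed.add, Timed.mul, add_assoc]

theorem projLoop_steps {d M : ℕ} (s : Fin d ⊕ Fin d → Fin (M + 1) → ℝ) (w : Fin d → ℝ)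
    (q : Point d M) (l : List (Fin d)) (acc : ℝ) :
    (projLoop s w q l acc).steps = 8 * l.length := by
  induction l generalizing acc with
  | nil => simp [projLoop]
  | cons i l ih =>
    simp [projLoop, ih, Timed.load, Timed.add, Timed.mul, Timed.tick]
    ring

theorem queryBit_val {d M : ℕ} (a : Coord d M → ℝ) (w : Fin d → ℝ) (q : Point d M) :
    (queryBit (blockSums a) w q).val = (hashQuery a w q : ℕ) := by
  have h : (projLoop (blockSums a) w q (List.finRange d) 0).val =
      ∑ c, a c * queryTrans w q c := by
    rw [projLoop_val, zero_add, sum_coord, ← List.ofFn_eq_map, List.sum_ofFn]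
    exact Finset.sum_congr rfl fun i _ => blockSums_add_eq a w q i
  simp only [queryBit, Timed.val_bind, h, Timed.less, hashQuery, angularHash, decide_eq_true_eq]
  split_ifs <;> rfl

theorem queryBit_steps {d M : ℕ} (s : Fin d ⊕ Fin d → Fin (M + 1) → ℝ) (w : Fin d → ℝ)
    (q : Point d M) : (queryBit s w q).steps = 8 * d + 1 := by
  simp only [queryBit, Timed.steps_bind, projLoop_steps, List.length_finRange, Timed.less]
  split_ifs <;> rfl

/-- Horner's rule: the list is traversed from its end, so the first element ends up as the least
significant digit, as in `dataKey`. -/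
theorem keyLoop_val {d M k n : ℕ} (T : Table d M k n) (w : Fin d → ℝ) (q : Point d M)
    (l : List (Fin k)) (acc : ℕ) :
    (keyLoop T w q l.reverse acc).val =
      acc * 2 ^ l.length + Nat.ofDigits 2 (l.map fun j => (queryBit (T.sums j) w q).val) := by
  induction l using List.reverseRecOn generalizing acc with
  | nil => simp [keyLoop]
  | append_singleton l j ih =>
    simp [keyLoop, ih, Timed.add, Nat.ofDigits_append]
    ring

theorem keyLoop_steps {d M k n : ℕ} (T : Table d M k n) (w : Fin d → ℝ) (q : Point d M)
    (l : List (Fin k)) (acc : ℕ) :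
    (keyLoop T w q l acc).steps = l.length * (8 * d + 4) := by
  induction l generalizing acc with
  | nil => simp [keyLoop]
  | cons j l ih =>
    simp [keyLoop, ih, Timed.add, Timed.tick, queryBit_steps]
    ring

theorem queryKey_steps {d M k n : ℕ} (T : Table d M k n) (w : Fin d → ℝ) (q : Point d M) :
    (queryKey T w q).steps = k * (8 * d + 4) := by
  simp [queryKey, keyLoop_steps]

theorem queryKey_build_val {d M k L n : ℕ} (D : Fin n → Point d M) (a : Seeds d M k L) (t : Fin L)
    (w : Fin d → ℝ) (q : Point d M) :
    (queryKey ((build D a).tables t) w q).val =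
      Nat.ofDigits 2 (List.ofFn fun j => (hashQuery (a t j) w q : ℕ)) := by
  rw [queryKey, keyLoop_val, zero_mul, zero_add, List.ofFn_eq_map]
  simp only [build, queryBit_val]

/-- Packing loses nothing: binary expansions of equal length are determined by their value. -/
theorem dataKey_eq_queryKey_iff {d M k L n : ℕ} (D : Fin n → Point d M) (a : Seeds d M k L)
    (t : Fin L) (w : Fin d → ℝ) (q o : Point d M) :
    dataKey (a t) o = (queryKey ((build D a).tables t) w q).val ↔
      ∀ j, hashData (a t j) o = hashQuery (a t j) w q := by
  rw [queryKey_build_val, dataKey]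
  constructor
  · intro h j
    have := Nat.ofDigits_inj_of_len_eq one_lt_two (by simp)
      (by simp only [List.mem_ofFn]; rintro _ ⟨j, rfl⟩; exact Fin.is_lt _)
      (by simp only [List.mem_ofFn]; rintro _ ⟨j, rfl⟩; exact Fin.is_lt _) h
    exact Fin.ext (congrFun (List.ofFn_injective this) j)
  · intro h
    simp only [h]

/-! ### Binary search -/

/-- Loop invariant: keys before `lo` are below `κ`, keys from `hi` on are at least `κ`. Sortedness
extends the test at the midpoint to one side of it. -/
theorem search_val {n : ℕ} {key : Fin n → ℕ} (hkey : Monotone key) (κ : ℕ) (fuel lo hi : ℕ)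
    (hfuel : hi ≤ lo + fuel) (hle : lo ≤ hi) (hn : hi ≤ n)
    (hlo : ∀ i : Fin n, (i : ℕ) < lo → key i < κ)
    (hhi : ∀ i : Fin n, hi ≤ (i : ℕ) → κ ≤ key i) :
    (∀ i : Fin n, (i : ℕ) < (search key κ fuel lo hi).val → key i < κ) ∧
      ∀ i : Fin n, (search key κ fuel lo hi).val ≤ (i : ℕ) → κ ≤ key i := by
  induction fuel generalizing lo hi with
  | zero =>
    obtain rfl : lo = hi := by omega
    exact ⟨hlo, hhi⟩
  | succ fuel ih =>
    simp only [search, Timed.val_bind, Timed.less, Timed.add, Timed.half, Timed.load,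
      decide_eq_true_eq]
    by_cases h : lo < hi
    · have hmid : (lo + hi) / 2 < n := by omega
      simp only [h, if_true, hmid, dif_pos, Timed.val_bind, decide_eq_true_eq]
      split_ifs with hx
      · refine ih ((lo + hi) / 2 + 1) hi (by omega) (by omega) hn
          (fun i (hi' : (i : ℕ) < _ + 1) => ?_) hhi
        exact (hkey (show i ≤ ⟨(lo + hi) / 2, hmid⟩ from Fin.mk_le_mk.2 (by omega))).trans_lt hx
      · refine ih _ _ (by omega) (by omega) (by omega) hlo (fun i hi' => ?_)
        exact (not_lt.1 hx).trans (hkey (Fin.mk_le_mk.2 hi'))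
    · obtain rfl : lo = hi := by omega
      simpa using ⟨hlo, hhi⟩

/-- Each round costs at most 6 and halves the interval; the last 1 is the failing comparison.
Neither sortedness nor the fuel matters for the cost. -/
theorem search_steps {n : ℕ} (key : Fin n → ℕ) (κ fuel lo hi m : ℕ) (h : hi < lo + 2 ^ m) :
    (search key κ fuel lo hi).steps ≤ 6 * m + 1 := by
  induction fuel generalizing lo hi m with
  | zero => simp [search]
  | succ fuel ih =>
    simp only [search, Timed.steps_bind, Timed.less, Timed.add, Timed.half, Timed.load,
      decide_eq_true_eq]
    by_cases hlt : lo < hi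
    · rw [if_pos hlt]
      obtain ⟨m, rfl⟩ : ∃ m', m = m' + 1 := Nat.exists_eq_succ_of_ne_zero (by
        rintro rfl
        simp at h
        omega)
      rw [pow_succ] at h
      simp only [Timed.steps_bind]
      by_cases hmid : (lo + hi) / 2 < n
      · rw [dif_pos hmid]
        simp only [Timed.steps_bind, decide_eq_true_eq]
        split_ifs with hx
        · have := ih ((lo + hi) / 2 + 1) hi m (by omega)
          simp only [Timed.steps_bind]
          omega
        · have := ih lo ((lo + hi) / 2) m (by omega)
          omega
      · rw [dif_neg hmid]
        simp only [Timed.steps_pure]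
        omega
    · rw [if_neg hlt]
      simp

/-! ### Scanning the buckets -/

theorem Timed.ext {α : Type} {x y : Timed α} (hv : x.val = y.val) (hs : x.steps = y.steps) :
    x = y := by
  cases x
  cases y
  simp_all

theorem distLoop_val {d M : ℕ} (w : Fin d → ℝ) (o q : Point d M) (l : List (Fin d)) (acc : ℝ) :
    (distLoop w o q l acc).val =
      acc + (l.map fun i => w i * |((o i : ℕ) : ℝ) - ((q i : ℕ) : ℝ)|).sum := by
  induction l generalizing acc with
  | nil => simp [distLoop]
  | cons i l ih =>
    simp [distLoop, ih, Timed.load, Timed.add, Timed.mul, Timed.sub, Timed.abs, add_assoc]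

theorem distLoop_finRange_val {d M : ℕ} (w : Fin d → ℝ) (o q : Point d M) :
    (distLoop w o q (List.finRange d) 0).val = wdist w o q := by
  rw [distLoop_val, zero_add, ← List.ofFn_eq_map, List.sum_ofFn, wdist]

theorem distLoop_steps {d M : ℕ} (w : Fin d → ℝ) (o q : Point d M) (l : List (Fin d)) (acc : ℝ) :
    (distLoop w o q l acc).steps = 8 * l.length := by
  induction l generalizing acc with
  | nil => simp [distLoop]
  | cons i l ih =>
    simp [distLoop, ih, Timed.load, Timed.add, Timed.mul, Timed.sub, Timed.abs, Timed.tick]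
    ring

open Classical in
/-- The positions from `pos` on that hold a far point with key `κ`. -/
noncomputable def farPositions {d M k L n : ℕ} (S : Index d M k L n) (T : Table d M k n)
    (w : Fin d → ℝ) (q : Point d M) (R₂ : ℝ) (κ pos : ℕ) : Finset (Fin n) :=
  {i | pos ≤ (i : ℕ) ∧ T.key i = κ ∧ R₂ < wdist w (S.data (T.id i)) q}

section scan

variable {d M k L n : ℕ} (S : Index d M k L n) (T : Table d M k n) (w : Fin d → ℝ) (q : Point d M)
  (R₂ : ℝ) (κ : ℕ)

theorem scan_zero (pos : ℕ) : scan S T w q R₂ κ 0 pos = ⟨(none, 0), 1⟩ := rfl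

theorem scan_succ_of_near (budget : ℕ) (i : Fin n) (hi : T.key i = κ)
    (h : wdist w (S.data (T.id i)) q ≤ R₂) :
    scan S T w q R₂ κ (budget + 1) i = ⟨(some (T.id i), budget), 8 * d + 7⟩ := by
  apply Timed.ext
  · simp [scan, Timed.tick, Timed.less, Timed.load, Timed.equal, hi,
      distLoop_finRange_val, not_lt.2 h]
  · simp [scan, Timed.tick, Timed.less, Timed.load, Timed.equal, hi,
      distLoop_finRange_val, distLoop_steps, not_lt.2 h]
    ring

theorem scan_succ_of_far (budget : ℕ) (i : Fin n) (hi : T.key i = κ)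
    (h : R₂ < wdist w (S.data (T.id i)) q) :
    scan S T w q R₂ κ (budget + 1) i =
      ⟨(scan S T w q R₂ κ budget (i + 1)).val,
        8 * d + 8 + (scan S T w q R₂ κ budget (i + 1)).steps⟩ := by
  apply Timed.ext
  · simp [scan, Timed.tick, Timed.less, Timed.load, Timed.equal, Timed.add, hi,
      distLoop_finRange_val, h]
  · simp [scan, Timed.tick, Timed.less, Timed.load, Timed.equal, Timed.add, hi,
      distLoop_finRange_val, distLoop_steps, h]
    ring

theorem scan_succ_of_key_ne (budget : ℕ) (i : Fin n) (hi : T.key i ≠ κ) :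
    scan S T w q R₂ κ (budget + 1) i = ⟨(none, budget + 1), 4⟩ := by
  apply Timed.ext <;> simp [scan, Timed.tick, Timed.less, Timed.load, Timed.equal, hi]

theorem scan_succ_of_le (budget pos : ℕ) (h : n ≤ pos) :
    scan S T w q R₂ κ (budget + 1) pos = ⟨(none, budget + 1), 2⟩ := by
  apply Timed.ext <;> simp [scan, Timed.tick, Timed.less, not_lt.2 h]

/-- The remaining budget acts as a potential: each unit pays for one examined point, and the 4
covers the final step that examines none. -/
theorem scan_steps (budget pos : ℕ) :
    (scan S T w q R₂ κ budget pos).steps +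
      (scan S T w q R₂ κ budget pos).val.2 * (8 * d + 8) ≤ budget * (8 * d + 8) + 4 := by
  induction budget generalizing pos with
  | zero => simp [scan_zero]
  | succ budget ih =>
    rcases le_or_gt n pos with h | h
    · rw [scan_succ_of_le S T w q R₂ κ budget pos h]
      linarith
    lift pos to Fin n using h
    by_cases hk : T.key pos = κ
    · rcases le_or_gt (wdist w (S.data (T.id pos)) q) R₂ with hr | hr
      · rw [scan_succ_of_near S T w q R₂ κ budget pos hk hr]
        linarith
      · rw [scan_succ_of_far S T w q R₂ κ budget pos hk hr]
        linarith [ih (pos + 1)]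
    · rw [scan_succ_of_key_ne S T w q R₂ κ budget pos hk]
      linarith

theorem wdist_le_of_scan_eq_some (budget pos : ℕ) {m : Fin n}
    (hm : (scan S T w q R₂ κ budget pos).val.1 = some m) : wdist w (S.data m) q ≤ R₂ := by
  induction budget generalizing pos with
  | zero => simp [scan_zero] at hm
  | succ budget ih =>
    rcases le_or_gt n pos with h | h
    · simp [scan_succ_of_le S T w q R₂ κ budget pos h] at hm
    lift pos to Fin n using h
    by_cases hk : T.key pos = κ
    · rcases le_or_gt (wdist w (S.data (T.id pos)) q) R₂ with hr | hr
      · rw [scan_succ_of_near S T w q R₂ κ budget pos hk hr] at hm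
        obtain rfl := Option.some_injective _ hm
        exact hr
      · rw [scan_succ_of_far S T w q R₂ κ budget pos hk hr] at hm
        exact ih _ hm
    · simp [scan_succ_of_key_ne S T w q R₂ κ budget pos hk] at hm

/-- Every unit of budget spent is charged to a different far position. If some budget is left, the
scan stopped at the end of the bucket, so it overlooked no near point. -/
theorem scan_eq_none (hkey : Monotone T.key) (budget pos : ℕ)
    (hpos : ∀ i : Fin n, pos ≤ (i : ℕ) → κ ≤ T.key i)
    (hnone : (scan S T w q R₂ κ budget pos).val.1 = none) :
    budget ≤ (scan S T w q R₂ κ budget pos).val.2 + (farPositions S T w q R₂ κ pos).card ∧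
      (0 < (scan S T w q R₂ κ budget pos).val.2 →
        ∀ i : Fin n, pos ≤ (i : ℕ) → T.key i = κ → R₂ < wdist w (S.data (T.id i)) q) := by
  induction budget generalizing pos with
  | zero => simp [scan_zero]
  | succ budget ih =>
    rcases le_or_gt n pos with h | h
    · rw [scan_succ_of_le S T w q R₂ κ budget pos h]
      exact ⟨by simp, fun _ i hi => absurd i.2 (by omega)⟩
    lift pos to Fin n using h
    by_cases hk : T.key pos = κ
    · rcases le_or_gt (wdist w (S.data (T.id pos)) q) R₂ with hr | hr
      · simp [scan_succ_of_near S T w q R₂ κ budget pos hk hr] at hnone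
      · rw [scan_succ_of_far S T w q R₂ κ budget pos hk hr] at hnone ⊢
        obtain ⟨h1, h2⟩ := ih (pos + 1) (fun i hi => hpos i (by omega)) hnone
        -- The position just examined is far and leaves the set, which pays for the unit spent.
        have hcard : (farPositions S T w q R₂ κ (pos + 1)).card <
            (farPositions S T w q R₂ κ pos).card := by
          refine Finset.card_lt_card (Finset.ssubset_iff_of_subset ?_ |>.2 ⟨pos, ?_, ?_⟩)
          · intro i
            simp only [farPositions, Finset.mem_filter_univ]
            exact fun ⟨a, b⟩ => ⟨by omega, b⟩
          · simp only [farPositions, Finset.mem_filter_univ]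
            exact ⟨le_rfl, hk, hr⟩
          · simp [farPositions]
        refine ⟨by simp only; omega, fun h0 i hi hik => ?_⟩
        rcases hi.eq_or_lt with he | hl
        · rwa [← Fin.ext he]
        · exact h2 h0 i hl hik
    · rw [scan_succ_of_key_ne S T w q R₂ κ budget pos hk]
      refine ⟨by simp, fun _ i hi hik => absurd ?_ hk⟩
      -- A later occurrence of `κ` would squeeze the current key to `κ`, since the array is sorted.
      exact le_antisymm (hik ▸ hkey hi) (hpos pos le_rfl)

end scan

/-! ### The query algorithm -/

section tableLoop

variable {d M k L n : ℕ} (S : Index d M k L n) (w : Fin d → ℝ) (q : Point d M) (R₂ : ℝ)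

/-- The scan of the bucket of the query in the table `t`. -/
noncomputable def bucketScan (t : Fin L) (budget : ℕ) : Timed (Option (Fin n) × ℕ) :=
  scan S (S.tables t) w q R₂ (queryKey (S.tables t) w q).val budget
    (search (S.tables t).key (queryKey (S.tables t) w q).val n 0 n).val

theorem tableLoop_cons_of_some {t : Fin L} {budget rest : ℕ} {m : Fin n} (ts : List (Fin L))
    (h : (bucketScan S w q R₂ t budget).val = (some m, rest)) :
    tableLoop S w q R₂ (t :: ts) budget = ⟨some m, (queryKey (S.tables t) w q).steps +
      (search (S.tables t).key (queryKey (S.tables t) w q).val n 0 n).steps +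
      (bucketScan S w q R₂ t budget).steps + 2⟩ := by
  apply Timed.ext
  · simp only [tableLoop, Timed.val_bind]
    rw [← bucketScan, h]
    rfl
  · simp only [tableLoop, Timed.steps_bind]
    rw [← bucketScan, h]
    simp [Timed.tick]
    ring

theorem tableLoop_cons_of_none {t : Fin L} {budget rest : ℕ} (ts : List (Fin L))
    (h : (bucketScan S w q R₂ t budget).val = (none, rest)) :
    tableLoop S w q R₂ (t :: ts) budget = ⟨(tableLoop S w q R₂ ts rest).val,
      (queryKey (S.tables t) w q).steps +
      (search (S.tables t).key (queryKey (S.tables t) w q).val n 0 n).steps +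
      (bucketScan S w q R₂ t budget).steps + 2 + (tableLoop S w q R₂ ts rest).steps⟩ := by
  apply Timed.ext
  · simp only [tableLoop, Timed.val_bind]
    rw [← bucketScan, h]
  · simp only [tableLoop, Timed.steps_bind]
    rw [← bucketScan, h]
    simp [Timed.tick]
    ring

/-- Per table, `6 * m + 7` is the search, the 4 that ends a scan and two loop instructions. Examined
points are paid from the common budget, so their term is not multiplied by the number of tables. -/
theorem tableLoop_steps {m : ℕ} (hm : n < 2 ^ m) (ts : List (Fin L)) (budget : ℕ) :
    (tableLoop S w q R₂ ts budget).steps ≤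
      ts.length * (k * (8 * d + 4) + (6 * m + 7)) + budget * (8 * d + 8) := by
  induction ts generalizing budget with
  | nil => simp [tableLoop]
  | cons t ts ih =>
    have h1 := queryKey_steps (S.tables t) w q
    have h2 := search_steps (S.tables t).key (queryKey (S.tables t) w q).val n 0 n m (by omega)
    have h3 : (bucketScan S w q R₂ t budget).steps +
      (bucketScan S w q R₂ t budget).val.2 * (8 * d + 8) ≤ budget * (8 * d + 8) + 4 :=
        scan_steps _ _ _ _ _ _ _ _
    rw [List.length_cons, add_one_mul]
    rcases hs : (bucketScan S w q R₂ t budget).val with ⟨_ | p, rest⟩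
    · rw [tableLoop_cons_of_none S w q R₂ ts hs]
      have := ih rest
      simp only [hs] at h3 ⊢
      omega
    · rw [tableLoop_cons_of_some S w q R₂ ts hs]
      simp only [hs] at h3 ⊢
      omega

theorem wdist_le_of_tableLoop_eq_some (ts : List (Fin L)) (budget : ℕ) {m : Fin n}
    (hm : (tableLoop S w q R₂ ts budget).val = some m) : wdist w (S.data m) q ≤ R₂ := by
  induction ts generalizing budget with
  | nil => simp [tableLoop] at hm
  | cons t ts ih =>
    rcases hs : (bucketScan S w q R₂ t budget).val with ⟨_ | p, rest⟩
    · rw [tableLoop_cons_of_none S w q R₂ ts hs] at hm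
      exact ih rest hm
    · rw [tableLoop_cons_of_some S w q R₂ ts hs] at hm
      obtain rfl := Option.some_injective _ hm
      exact wdist_le_of_scan_eq_some _ _ _ _ _ _ _ _ (congrArg Prod.fst hs)

end tableLoop

section build

variable {d M k L n : ℕ} (D : Fin n → Point d M) (a : Seeds d M k L) (w : Fin d → ℝ) (q : Point d M)
  (R₂ : ℝ)

/-- All hash bits of the data point `o` agree with those of the query. -/
def Collides (b : Fin k → Coord d M → ℝ) (o : Point d M) : Prop :=
  ∀ j, hashData (b j) o = hashQuery (b j) w q

open Classical in
/-- The far data points in the bucket of the query. -/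
noncomputable def farCollisions (b : Fin k → Coord d M → ℝ) : Finset (Fin n) :=
  {m | R₂ < wdist w (D m) q ∧ Collides w q b (D m)}

theorem monotone_key_build (t : Fin L) : Monotone ((build D a).tables t).key :=
  Tuple.monotone_sort fun m => dataKey (a t) (D m)

theorem key_build_eq_iff (t : Fin L) (i : Fin n) :
    ((build D a).tables t).key i = (queryKey ((build D a).tables t) w q).val ↔
      Collides w q (a t) (D (((build D a).tables t).id i)) :=
  dataKey_eq_queryKey_iff D a t w q _

theorem card_farPositions_build_le (t : Fin L) (pos : ℕ) :
    (farPositions (build D a) ((build D a).tables t) w q R₂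
      (queryKey ((build D a).tables t) w q).val pos).card ≤
    (farCollisions D w q R₂ (a t)).card := by
  refine Finset.card_le_card_of_injOn ((build D a).tables t).id (fun i hi => ?_)
    (Equiv.injective _).injOn
  simp only [farPositions, Finset.coe_filter, Finset.mem_univ, true_and, Set.mem_ofPred_eq,
    key_build_eq_iff] at hi
  simp only [farCollisions, Finset.coe_filter, Finset.mem_univ, true_and, Set.mem_ofPred_eq]
  exact ⟨hi.2.2, hi.2.1⟩

theorem bucketScan_build_eq_none {t : Fin L} {budget rest : ℕ}
    (h : (bucketScan (build D a) w q R₂ t budget).val = (none, rest)) :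
    budget ≤ rest + (farCollisions D w q R₂ (a t)).card ∧
      (0 < rest → ∀ m, Collides w q (a t) (D m) → R₂ < wdist w (D m) q) := by
  set κ := (queryKey ((build D a).tables t) w q).val with hκ
  obtain ⟨hlt, hge⟩ := search_val (monotone_key_build D a t) κ n 0 n (by omega) (by omega) le_rfl
    (fun i hi => absurd hi (by omega)) (fun i hi => absurd i.2 (by omega))
  have hnone := scan_eq_none (build D a) ((build D a).tables t) w q R₂ κ
    (monotone_key_build D a t) budget _ hge (congrArg Prod.fst h)
  have hrest : (scan (build D a) ((build D a).tables t) w q R₂ κ budget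
      (search ((build D a).tables t).key κ n 0 n).val).val.2 = rest := congrArg Prod.snd h
  rw [hrest] at hnone
  refine ⟨hnone.1.trans (Nat.add_le_add_left (card_farPositions_build_le D a w q R₂ t _) _),
    fun h0 m hm => ?_⟩
  -- Sorting permutes the data points, so each one occurs in the table; the search result cannot lie
  -- beyond a position with key `κ`.
  obtain ⟨i, rfl⟩ : ∃ i, ((build D a).tables t).id i = m :=
    ⟨_, Equiv.apply_symm_apply (Tuple.sort fun m => dataKey (a t) (D m)) m⟩
  have hkey := (key_build_eq_iff D a w q t i).2 hm
  refine hnone.2 h0 i (not_lt.1 fun hc => ?_) hkey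
  exact absurd hkey (hlt i hc).ne

/-- Unsuccessful scans spend budget only on far collisions, so some budget always remains. In the
table where the near point collides, the scan therefore cannot come back empty. -/
theorem tableLoop_build_ne_none {m : Fin n} (hm : wdist w (D m) q ≤ R₂) (ts : List (Fin L))
    (budget : ℕ) (hnear : ∃ t ∈ ts, Collides w q (a t) (D m))
    (hfar : (ts.map fun t => (farCollisions D w q R₂ (a t)).card).sum < budget) :
    (tableLoop (build D a) w q R₂ ts budget).val ≠ none := by
  induction ts generalizing budget with
  | nil => simp at hnear
  | cons t ts ih =>
    rw [List.map_cons, List.sum_cons] at hfar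
    rcases hs : (bucketScan (build D a) w q R₂ t budget).val with ⟨_ | p, rest⟩
    · rw [tableLoop_cons_of_none _ w q R₂ ts hs]
      obtain ⟨h1, h2⟩ := bucketScan_build_eq_none D a w q R₂ hs
      obtain ⟨t', ht', hc⟩ := hnear
      refine ih rest ⟨t', ?_, hc⟩ (by omega)
      rcases List.mem_cons.1 ht' with rfl | ht'
      · exact absurd hm (not_le.2 (h2 (by omega) m hc))
      · exact ht'
    · rw [tableLoop_cons_of_some _ w q R₂ ts hs]
      simp

theorem isCorrectAnswer_query (R₁ : ℝ) {m : Fin n} (hm : wdist w (D m) q ≤ R₂) {cap : ℕ}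
    (hnear : ∃ t, Collides w q (a t) (D m))
    (hfar : ∑ t, (farCollisions D w q R₂ (a t)).card < cap) :
    IsCorrectAnswer w R₁ R₂ D q (query cap (build D a) w q R₂).val := by
  intro _
  obtain ⟨t, ht⟩ := hnear
  have := tableLoop_build_ne_none D a w q R₂ hm (List.finRange L) cap
    ⟨t, List.mem_finRange t, ht⟩ (by rwa [← List.ofFn_eq_map, List.sum_ofFn])
  obtain ⟨p, hp⟩ := Option.ne_none_iff_exists'.1 this
  exact ⟨p, hp, wdist_le_of_tableLoop_eq_some (build D a) w q R₂ _ _ hp⟩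

end build

theorem query_steps {d M k L n : ℕ} (S : Index d M k L n) (w : Fin d → ℝ) (q : Point d M) (R₂ : ℝ)
    (cap : ℕ) {m : ℕ} (hm : n < 2 ^ m) :
    (query cap S w q R₂).steps ≤ L * (k * (8 * d + 4) + (6 * m + 7)) + cap * (8 * d + 8) := by
  simpa [query] using tableLoop_steps S w q R₂ hm (List.finRange L) cap

/-! ### Success probability -/

instance isProbabilityMeasure_directionLaw (d M : ℕ) : IsProbabilityMeasure (directionLaw d M) := by
  unfold directionLaw
  infer_instance

instance isProbabilityMeasure_seedLaw (d M k L : ℕ) : IsProbabilityMeasure (seedLaw d M k L) := by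
  unfold seedLaw
  infer_instance

theorem measurable_angularHash {ι : Type} [Fintype ι] (x : ι → ℝ) :
    Measurable fun a : ι → ℝ => angularHash a x :=
  Measurable.ite (measurableSet_lt (by fun_prop) measurable_const) measurable_const measurable_const

theorem measurableSet_hashData_eq_hashQuery {d M : ℕ} (w : Fin d → ℝ) (o q : Point d M) :
    MeasurableSet {a : Coord d M → ℝ | hashData a o = hashQuery a w q} :=
  measurableSet_eq_fun (measurable_angularHash _) (measurable_angularHash _)

theorem setOf_collides_eq_pi {d M k : ℕ} (w : Fin d → ℝ) (o q : Point d M) :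
    {b : Fin k → Coord d M → ℝ | Collides w q b o} =
      Set.univ.pi fun _ => {a | hashData a o = hashQuery a w q} := by
  ext b
  simp [Collides]

theorem measurableSet_collides {d M k : ℕ} (w : Fin d → ℝ) (o q : Point d M) :
    MeasurableSet {b : Fin k → Coord d M → ℝ | Collides w q b o} := by
  rw [setOf_collides_eq_pi]
  exact MeasurableSet.univ_pi fun _ => measurableSet_hashData_eq_hashQuery w o q

section

variable {d M : ℕ} (hd : 0 < d) (hM : 0 < M) {w : Fin d → ℝ} (hw : w ≠ 0) (k L : ℕ)

include hd hM hw

theorem pi_directionLaw_collides (o q : Point d M) :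
    (Measure.pi fun _ : Fin k => directionLaw d M).real {b | Collides w q b o} =
      collisionProb M w (wdist w o q) ^ k := by
  rw [setOf_collides_eq_pi, Measure.real, Measure.pi_pi, Finset.prod_const, Finset.card_univ,
    Fintype.card_fin, ENNReal.toReal_pow, ← directionLaw_hashData_eq_hashQuery hd hM hw o q]
  rfl

theorem seedLaw_forall_not_collides (o q : Point d M) :
    (seedLaw d M k L).real {a | ∀ t, ¬Collides w q (a t) o} =
      (1 - collisionProb M w (wdist w o q) ^ k) ^ L := by
  have hset : {a : Seeds d M k L | ∀ t, ¬Collides w q (a t) o} =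
      Set.univ.pi fun _ => {b | Collides w q b o}ᶜ := by
    ext a
    simp
  rw [hset, Measure.real, seedLaw, Measure.pi_pi, Finset.prod_const, Finset.card_univ,
    Fintype.card_fin, ENNReal.toReal_pow, ← pi_directionLaw_collides hd hM hw k o q,
    ← probReal_compl_eq_one_sub (measurableSet_collides w o q)]
  rfl

theorem seedLaw_collides (t : Fin L) (o q : Point d M) :
    seedLaw d M k L {a | Collides w q (a t) o} =
      ENNReal.ofReal (collisionProb M w (wdist w o q) ^ k) := by
  rw [← pi_directionLaw_collides hd hM hw k o q, ofReal_measureReal]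
  exact (measurePreserving_eval (fun _ : Fin L => Measure.pi fun _ : Fin k => directionLaw d M)
    t).measure_preimage (measurableSet_collides w o q).nullMeasurableSet

/-- Markov's inequality for the number of far data points in the buckets of the query. -/
theorem seedLaw_many_farCollisions {n : ℕ} (D : Fin n → Point d M) (q : Point d M) {R₂ : ℝ}
    (h2 : 0 ≤ collisionProb M w R₂) {cap : ℕ} (hcap : 0 < cap) :
    (seedLaw d M k L).real {a | cap ≤ ∑ t, (farCollisions D w q R₂ (a t)).card} ≤
      L * (n * collisionProb M w R₂ ^ k) / cap := by
  classical
  set F : Seeds d M k L → ENNReal := fun a => ∑ t, ∑ m,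
    {a : Seeds d M k L | R₂ < wdist w (D m) q ∧ Collides w q (a t) (D m)}.indicator 1 a with hF
  have hmeas : ∀ t m, MeasurableSet
      {a : Seeds d M k L | R₂ < wdist w (D m) q ∧ Collides w q (a t) (D m)} := fun t m =>
    (MeasurableSet.const _).inter
      ((measurableSet_collides w (D m) q).preimage (measurable_pi_apply t))
  have hFm : Measurable F := by
    refine Finset.measurable_fun_sum _ fun t _ => Finset.measurable_fun_sum _ fun m _ => ?_
    exact measurable_one.indicator (hmeas t m)
  have hcard : ∀ a, F a = ((∑ t, (farCollisions D w q R₂ (a t)).card : ℕ) : ENNReal) := by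
    intro a
    rw [Nat.cast_sum]
    refine Finset.sum_congr rfl fun t _ => ?_
    rw [farCollisions, Finset.natCast_card_filter]
    exact Finset.sum_congr rfl fun m _ => by simp [Set.indicator_apply]
  have hint : ∫⁻ a, F a ∂seedLaw d M k L ≤
      ENNReal.ofReal (L * (n * collisionProb M w R₂ ^ k)) := by
    have hle : ∀ t m, ∫⁻ a, {a : Seeds d M k L | R₂ < wdist w (D m) q ∧
        Collides w q (a t) (D m)}.indicator 1 a ∂seedLaw d M k L ≤
        ENNReal.ofReal (collisionProb M w R₂ ^ k) := by
      intro t m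
      rw [lintegral_indicator_one (hmeas t m)]
      by_cases h : R₂ < wdist w (D m) q
      · simp only [h, true_and]
        rw [seedLaw_collides hd hM hw]
        -- Monotonicity of powers needs a nonnegative base, which holds because the base is a
        -- probability.
        refine ENNReal.ofReal_le_ofReal (pow_le_pow_left₀ ?_ (collisionProb_anti w h.le) k)
        rw [← directionLaw_hashData_eq_hashQuery hd hM hw]
        exact measureReal_nonneg
      · simp [h]
    calc ∫⁻ a, F a ∂seedLaw d M k L
        = ∑ t : Fin L, ∑ m, ∫⁻ a, {a : Seeds d M k L | R₂ < wdist w (D m) q ∧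
            Collides w q (a t) (D m)}.indicator 1 a ∂seedLaw d M k L := by
          rw [hF, lintegral_finsetSum]
          · refine Finset.sum_congr rfl fun t _ => ?_
            rw [lintegral_finsetSum]
            exact fun m _ => measurable_one.indicator (hmeas t m)
          · exact fun t _ => Finset.measurable_fun_sum _ fun m _ =>
              measurable_one.indicator (hmeas t m)
      _ ≤ ∑ _t : Fin L, ∑ _m : Fin n, ENNReal.ofReal (collisionProb M w R₂ ^ k) :=
          Finset.sum_le_sum fun t _ => Finset.sum_le_sum fun m _ => hle t m
      _ = ENNReal.ofReal (L * (n * collisionProb M w R₂ ^ k)) := by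
          rw [ENNReal.ofReal_mul (by positivity), ENNReal.ofReal_mul (by positivity)]
          simp
  have hmarkov := (mul_meas_ge_le_lintegral (μ := seedLaw d M k L) hFm cap).trans hint
  simp only [hcard, Nat.cast_le] at hmarkov
  rw [le_div_iff₀' (by positivity), Measure.real]
  have := ENNReal.toReal_mono ENNReal.ofReal_ne_top hmarkov
  rwa [ENNReal.toReal_mul, ENNReal.toReal_natCast, ENNReal.toReal_ofReal (by positivity)] at this

/-- Union bound over the two bad events. Covering the whole space and using subadditivity avoids
measurability of the success event. -/
theorem seedLaw_isCorrectAnswer {n : ℕ} (D : Fin n → Point d M) (q : Point d M) {R₁ R₂ : ℝ}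
    (hR : R₁ ≤ R₂) (h2 : 0 ≤ collisionProb M w R₂) {cap : ℕ} (hcap : 0 < cap) :
    1 - ((1 - collisionProb M w R₁ ^ k) ^ L + L * (n * collisionProb M w R₂ ^ k) / cap) ≤
      (seedLaw d M k L).real {a | IsCorrectAnswer w R₁ R₂ D q
        (query cap (build D a) w q R₂).val} := by
  have h1 := h2.trans (collisionProb_anti w hR)
  have h1' := pow_le_one₀ h1 (collisionProb_le_one w R₁) (n := k)
  by_cases hnear : ∃ m, wdist w (D m) q ≤ R₁
  · obtain ⟨m, hm⟩ := hnear
    have hsub : (Set.univ : Set (Seeds d M k L)) ⊆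
        {a | IsCorrectAnswer w R₁ R₂ D q (query cap (build D a) w q R₂).val} ∪
        ({a | ∀ t, ¬Collides w q (a t) (D m)} ∪
          {a | cap ≤ ∑ t, (farCollisions D w q R₂ (a t)).card}) := by
      intro a _
      by_contra hc
      simp only [Set.mem_union, Set.mem_ofPred_eq, not_or, not_forall, not_not, not_le] at hc
      exact hc.1 (isCorrectAnswer_query D a w q R₂ R₁ (hm.trans hR) hc.2.1 hc.2.2)
    have hle := (measureReal_mono (μ := seedLaw d M k L) hsub).trans
      ((measureReal_union_le _ _).trans (add_le_add_right (measureReal_union_le _ _) _))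
    rw [probReal_univ, seedLaw_forall_not_collides hd hM hw] at hle
    have hfar := seedLaw_many_farCollisions hd hM hw k L D q h2 hcap
    have hpow : (1 - collisionProb M w (wdist w (D m) q) ^ k) ^ L ≤
        (1 - collisionProb M w R₁ ^ k) ^ L := by
      have hmono := collisionProb_anti (M := M) w hm
      have := pow_le_one₀ (h1.trans hmono) (collisionProb_le_one w _) (n := k)
      refine pow_le_pow_left₀ (by linarith) ?_ L
      have := pow_le_pow_left₀ h1 hmono k
      linarith
    linarith
  · have : {a : Seeds d M k L | IsCorrectAnswer w R₁ R₂ D q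
        (query cap (build D a) w q R₂).val} = Set.univ :=
      Set.eq_univ_of_forall fun a h => absurd h hnear
    rw [this, probReal_univ, sub_le_self_iff]
    have : 0 ≤ (1 - collisionProb M w R₁ ^ k) ^ L := pow_nonneg (by linarith) L
    positivity

end

/-! ### Choice of the parameters -/

/-- Number of directions per table. -/
noncomputable def numBits (P₂ : ℝ) (n : ℕ) : ℕ := ⌈Real.log n / -Real.log P₂⌉₊

/-- The logarithm of the inverse of the admissible probability that a near point is missed by
every table. -/
noncomputable def missExponent (δ : ℝ) : ℝ := max (Real.log (2 / δ)) 0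

/-- Number of tables. -/
noncomputable def numTables (δ P₁ P₂ : ℝ) (n : ℕ) : ℕ :=
  ⌈missExponent δ / P₁ * (n : ℝ) ^ (Real.log P₁ / Real.log P₂)⌉₊

/-- Number of data points that a query may examine. -/
noncomputable def numExamined (δ P₁ P₂ : ℝ) (n : ℕ) : ℕ := ⌈2 / δ * numTables δ P₁ P₂ n⌉₊ + 1

/-- The constant in the bound for `numBits`. -/
noncomputable def bitsConst (P₂ : ℝ) : ℝ := 1 / -Real.log P₂ + 1 / Real.log 2

/-- The constant in the bound for `numTables`. -/
noncomputable def tablesConst (δ P₁ : ℝ) : ℝ := missExponent δ / P₁ + 1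

/-- The constant in the bound for `numExamined`. -/
noncomputable def examinedConst (δ P₁ : ℝ) : ℝ := 2 / δ * tablesConst δ P₁ + 2

/-- The constant in the bound for the space. -/
noncomputable def spaceConst (δ P₁ P₂ : ℝ) : ℝ :=
  1 + 4 * (tablesConst δ P₁ * bitsConst P₂) + 2 * tablesConst δ P₁

/-- The constant in the bound for the query time. -/
noncomputable def timeConst (δ P₁ P₂ : ℝ) : ℝ :=
  tablesConst δ P₁ * (12 * bitsConst P₂ + 26 / Real.log 2) +
    16 / Real.log 2 * examinedConst δ P₁

section

variable {δ P₁ P₂ : ℝ} {n : ℕ}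

theorem missExponent_nonneg (δ : ℝ) : 0 ≤ missExponent δ := le_max_right _ _

theorem bitsConst_pos (h2 : 0 < P₂) (h2' : P₂ < 1) : 0 < bitsConst P₂ := by
  have := Real.log_neg h2 h2'
  have : 0 < -Real.log P₂ := by linarith
  have := Real.log_pos one_lt_two
  unfold bitsConst
  positivity

theorem tablesConst_pos (δ : ℝ) (h1 : 0 < P₁) : 0 < tablesConst δ P₁ := by
  have := missExponent_nonneg δ
  unfold tablesConst
  positivity

theorem examinedConst_pos (hδ : 0 < δ) (h1 : 0 < P₁) : 0 < examinedConst δ P₁ := by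
  have := tablesConst_pos δ h1
  unfold examinedConst
  positivity

theorem spaceConst_pos (δ : ℝ) (h1 : 0 < P₁) (h2 : 0 < P₂) (h2' : P₂ < 1) :
    0 < spaceConst δ P₁ P₂ := by
  have := tablesConst_pos δ h1
  have := bitsConst_pos h2 h2'
  unfold spaceConst
  positivity

theorem timeConst_pos (hδ : 0 < δ) (h1 : 0 < P₁) (h2 : 0 < P₂) (h2' : P₂ < 1) :
    0 < timeConst δ P₁ P₂ := by
  have := tablesConst_pos δ h1
  have := bitsConst_pos h2 h2'
  have := examinedConst_pos hδ h1
  have := Real.log_pos one_lt_two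
  unfold timeConst
  positivity

theorem log_two_le_log (hn : 2 ≤ n) : Real.log 2 ≤ Real.log n :=
  Real.log_le_log two_pos (by exact_mod_cast hn)

theorem one_le_log_div (hn : 2 ≤ n) : 1 ≤ Real.log n / Real.log 2 :=
  (one_le_div (Real.log_pos one_lt_two)).2 (log_two_le_log hn)

theorem numBits_le (h2 : 0 < P₂) (h2' : P₂ < 1) (hn : 2 ≤ n) :
    (numBits P₂ n : ℝ) ≤ bitsConst P₂ * Real.log n := by
  have hl := Real.log_neg h2 h2'
  have hl2 : 0 < -Real.log P₂ := by linarith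
  have hlog := (Real.log_pos one_lt_two).le.trans (log_two_le_log hn)
  have h := (Nat.ceil_lt_add_one (div_nonneg hlog hl2.le)).le
  have h1 := one_le_log_div hn
  calc (numBits P₂ n : ℝ) ≤ Real.log n / -Real.log P₂ + 1 := h
    _ ≤ Real.log n / -Real.log P₂ + Real.log n / Real.log 2 := by linarith
    _ = bitsConst P₂ * Real.log n := by unfold bitsConst; ring

theorem mul_pow_numBits_le_one (h2 : 0 < P₂) (h2' : P₂ < 1) (hn : 2 ≤ n) :
    n * P₂ ^ numBits P₂ n ≤ 1 := by
  have hl2 : 0 < -Real.log P₂ := by linarith [Real.log_neg h2 h2']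
  have hn0 : (0 : ℝ) < n := by positivity
  have hk : Real.log n / -Real.log P₂ ≤ numBits P₂ n := Nat.le_ceil _
  rw [div_le_iff₀ hl2] at hk
  rw [← Real.log_nonpos_iff (by positivity), Real.log_mul hn0.ne' (by positivity), Real.log_pow]
  linarith

/-- Rounding the number of bits up costs at most one extra factor `P₁`; without rounding the power
would be `n ^ (-ρ)`. -/
theorem le_pow_numBits (h1 : 0 < P₁) (h1' : P₁ ≤ 1) (h2 : 0 < P₂) (h2' : P₂ < 1) (hn : 2 ≤ n) :
    P₁ / (n : ℝ) ^ (Real.log P₁ / Real.log P₂) ≤ P₁ ^ numBits P₂ n := by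
  have hl2 : 0 < -Real.log P₂ := by linarith [Real.log_neg h2 h2']
  have hl1 := Real.log_nonpos h1.le h1'
  have hn0 : (0 : ℝ) < n := by positivity
  have hlog := (Real.log_pos one_lt_two).le.trans (log_two_le_log hn)
  have hk := (Nat.ceil_lt_add_one (div_nonneg hlog hl2.le)).le
  change (numBits P₂ n : ℝ) ≤ _ at hk
  rw [← Real.log_le_log_iff (by positivity) (by positivity), Real.log_pow,
    Real.log_div h1.ne' (by positivity), Real.log_rpow hn0]
  have := mul_le_mul_of_nonpos_right hk hl1
  refine le_trans (le_of_eq ?_) this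
  rw [div_neg]
  ring

/-- By `1 - p ≤ exp (-p)` it suffices that the number of tables times `p` reaches `log (2 / δ)`; the
factor `1 / P₁` in `numTables` compensates the rounding of the number of bits. -/
theorem one_sub_pow_numTables_le (hδ : 0 < δ) (h1 : 0 < P₁) (h1' : P₁ ≤ 1) (h2 : 0 < P₂)
    (h2' : P₂ < 1) (hn : 2 ≤ n) :
    (1 - P₁ ^ numBits P₂ n) ^ numTables δ P₁ P₂ n ≤ δ / 2 := by
  have hn0 : (0 : ℝ) < n := by positivity
  set p := P₁ ^ numBits P₂ n
  set x := (n : ℝ) ^ (Real.log P₁ / Real.log P₂)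
  have hx : 0 < x := by positivity
  have hp1 : p ≤ 1 := pow_le_one₀ h1.le h1'
  have hp : P₁ / x ≤ p := le_pow_numBits h1 h1' h2 h2' hn
  have hL : missExponent δ / P₁ * x ≤ numTables δ P₁ P₂ n := Nat.le_ceil _
  have hA := missExponent_nonneg δ
  have hmul : missExponent δ ≤ numTables δ P₁ P₂ n * p := by
    calc missExponent δ = missExponent δ / P₁ * x * (P₁ / x) := by field_simp
      _ ≤ numTables δ P₁ P₂ n * p := by gcongr
  calc (1 - p) ^ numTables δ P₁ P₂ n ≤ Real.exp (-p) ^ numTables δ P₁ P₂ n :=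
        pow_le_pow_left₀ (by linarith) (Real.one_sub_le_exp_neg p) _
    _ = Real.exp (-(numTables δ P₁ P₂ n * p)) := by rw [← Real.exp_nat_mul]; ring_nf
    _ ≤ Real.exp (-Real.log (2 / δ)) :=
        Real.exp_le_exp.2 (neg_le_neg ((le_max_left _ _).trans hmul))
    _ = δ / 2 := by rw [← Real.log_inv, Real.exp_log (by positivity), inv_div]

theorem exponent_nonneg (h1 : 0 < P₁) (h1' : P₁ ≤ 1) (h2 : 0 < P₂) (h2' : P₂ < 1) :
    0 ≤ Real.log P₁ / Real.log P₂ :=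
  div_nonneg_of_nonpos (Real.log_nonpos h1.le h1') (Real.log_neg h2 h2').le

theorem one_le_rpow_exponent (h1 : 0 < P₁) (h1' : P₁ ≤ 1) (h2 : 0 < P₂) (h2' : P₂ < 1)
    (hn : 2 ≤ n) : 1 ≤ (n : ℝ) ^ (Real.log P₁ / Real.log P₂) :=
  Real.one_le_rpow (by exact_mod_cast (by omega : 1 ≤ n)) (exponent_nonneg h1 h1' h2 h2')

theorem numTables_le (δ : ℝ) (h1 : 0 < P₁) (h1' : P₁ ≤ 1) (h2 : 0 < P₂) (h2' : P₂ < 1)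
    (hn : 2 ≤ n) :
    (numTables δ P₁ P₂ n : ℝ) ≤ tablesConst δ P₁ * (n : ℝ) ^ (Real.log P₁ / Real.log P₂) := by
  have hx := one_le_rpow_exponent h1 h1' h2 h2' hn
  have hA := missExponent_nonneg δ
  have h := (Nat.ceil_lt_add_one (a := missExponent δ / P₁ *
    (n : ℝ) ^ (Real.log P₁ / Real.log P₂)) (by positivity)).le
  rw [tablesConst, add_mul]
  exact h.trans (by linarith)

theorem numExamined_le (hδ : 0 < δ) (h1 : 0 < P₁) (h1' : P₁ ≤ 1) (h2 : 0 < P₂) (h2' : P₂ < 1)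
    (hn : 2 ≤ n) :
    (numExamined δ P₁ P₂ n : ℝ) ≤
      examinedConst δ P₁ * (n : ℝ) ^ (Real.log P₁ / Real.log P₂) := by
  have hx := one_le_rpow_exponent h1 h1' h2 h2' hn
  have hL := mul_le_mul_of_nonneg_left (numTables_le δ h1 h1' h2 h2' hn)
    (by positivity : 0 ≤ 2 / δ)
  have h := (Nat.ceil_lt_add_one (a := 2 / δ * numTables δ P₁ P₂ n) (by positivity)).le
  rw [examinedConst, add_mul, numExamined, Nat.cast_add_one]
  linarith

theorem numTables_div_numExamined_le (hδ : 0 < δ) :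
    (numTables δ P₁ P₂ n : ℝ) / numExamined δ P₁ P₂ n ≤ δ / 2 := by
  have h := Nat.le_ceil (2 / δ * (numTables δ P₁ P₂ n : ℝ))
  have h' : 2 / δ * (numTables δ P₁ P₂ n : ℝ) ≤ numExamined δ P₁ P₂ n := by
    rw [numExamined, Nat.cast_add_one]
    linarith
  rw [div_le_iff₀ (by rw [numExamined]; positivity)]
  calc (numTables δ P₁ P₂ n : ℝ) = δ / 2 * (2 / δ * numTables δ P₁ P₂ n) := by field_simp
    _ ≤ δ / 2 * numExamined δ P₁ P₂ n := by gcongr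

theorem failure_bound (hδ : 0 < δ) (h1 : 0 < P₁) (h1' : P₁ ≤ 1) (h2 : 0 < P₂) (h2' : P₂ < 1)
    (hn : 2 ≤ n) :
    (1 - P₁ ^ numBits P₂ n) ^ numTables δ P₁ P₂ n + numTables δ P₁ P₂ n *
      (n * P₂ ^ numBits P₂ n) / numExamined δ P₁ P₂ n ≤ δ := by
  have hk := mul_pow_numBits_le_one h2 h2' hn
  have hmiss := one_sub_pow_numTables_le hδ h1 h1' h2 h2' hn
  have hfar : numTables δ P₁ P₂ n * (n * P₂ ^ numBits P₂ n) / numExamined δ P₁ P₂ n ≤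
      (numTables δ P₁ P₂ n : ℝ) / numExamined δ P₁ P₂ n := by
    gcongr
    exact mul_le_of_le_one_right (by positivity) hk
  linarith [numTables_div_numExamined_le (P₁ := P₁) (P₂ := P₂) (n := n) hδ]

theorem bucket_bound (h1 : 0 < P₁) (h1' : P₁ ≤ 1) (h2 : 0 < P₂) (h2' : P₂ < 1)
    (hn : 2 ≤ n) :
    (numTables δ P₁ P₂ n : ℝ) * (n + n) ≤
      2 * tablesConst δ P₁ * (n : ℝ) ^ (1 + Real.log P₁ / Real.log P₂) := by
  have hL := numTables_le δ h1 h1' h2 h2' hn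
  rw [Real.rpow_add (by positivity), Real.rpow_one]
  calc (numTables δ P₁ P₂ n : ℝ) * (n + n) ≤
        tablesConst δ P₁ * (n : ℝ) ^ (Real.log P₁ / Real.log P₂) * (n + n) := by gcongr
    _ = _ := by ring

theorem space_bound (h1 : 0 < P₁) (h1' : P₁ ≤ 1) (h2 : 0 < P₂) (h2' : P₂ < 1)
    (hn : 2 ≤ n) {d M : ℕ} (hd : 0 < d) (hM : 0 < M) :
    (n * d + numTables δ P₁ P₂ n * (numBits P₂ n * ((d + d) * (M + 1))) +
      numTables δ P₁ P₂ n * (n + n) : ℝ) ≤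
      spaceConst δ P₁ P₂ * (d * M) * (n : ℝ) ^ (1 + Real.log P₁ / Real.log P₂) := by
  have hL := numTables_le δ h1 h1' h2 h2' hn
  have hk := numBits_le h2 h2' hn
  have hb := bucket_bound (δ := δ) h1 h1' h2 h2' hn
  have hx := one_le_rpow_exponent h1 h1' h2 h2' hn
  have ha := tablesConst_pos δ h1
  have hbits := bitsConst_pos h2 h2'
  have hn0 : (0 : ℝ) < n := by positivity
  -- The block sums need a factor `log n` per table, absorbed by the `n` that the buckets cost
  -- anyway.
  have hlog : Real.log n ≤ n := (Real.log_le_sub_one_of_pos hn0).trans (by linarith)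
  have hd1 : (1 : ℝ) ≤ d := by exact_mod_cast hd
  have hM1 : (1 : ℝ) ≤ M := by exact_mod_cast hM
  have hdM : (1 : ℝ) ≤ d * M := one_le_mul_of_one_le_of_one_le hd1 hM1
  rw [Real.rpow_add (by positivity), Real.rpow_one] at hb ⊢
  set x := (n : ℝ) ^ (Real.log P₁ / Real.log P₂)
  have e1 : (n * d : ℝ) ≤ d * M * (n * x) := by
    calc (n * d : ℝ) = d * 1 * (n * 1) := by ring
      _ ≤ d * M * (n * x) := by gcongr
  have e2 : (numTables δ P₁ P₂ n * (numBits P₂ n * ((d + d) * (M + 1))) : ℝ) ≤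
      tablesConst δ P₁ * x * (bitsConst P₂ * n * ((d + d) * (M + M))) := by
    gcongr
    exact hk.trans (by gcongr)
  have e3 : 2 * tablesConst δ P₁ * (n * x) ≤ 2 * tablesConst δ P₁ * (n * x) * (d * M) :=
    le_mul_of_one_le_right (by positivity) hdM
  refine (add_le_add (add_le_add e1 e2) (hb.trans e3)).trans (le_of_eq ?_)
  unfold spaceConst
  ring

theorem time_bound (hδ : 0 < δ) (h1 : 0 < P₁) (h1' : P₁ ≤ 1) (h2 : 0 < P₂) (h2' : P₂ < 1)
    (hn : 2 ≤ n) {d : ℕ} (hd : 0 < d) :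
    (numTables δ P₁ P₂ n * (numBits P₂ n * (8 * d + 4) + (6 * (Nat.log 2 n + 1 : ℕ) + 7)) +
      numExamined δ P₁ P₂ n * (8 * d + 8) : ℝ) ≤
      timeConst δ P₁ P₂ * ((n : ℝ) ^ (Real.log P₁ / Real.log P₂) * d * Real.log n) := by
  have hL := numTables_le δ h1 h1' h2 h2' hn
  have hk := numBits_le h2 h2' hn
  have hc := numExamined_le hδ h1 h1' h2 h2' hn
  have hx := one_le_rpow_exponent h1 h1' h2 h2' hn
  have ha := tablesConst_pos δ h1
  have hbits := bitsConst_pos h2 h2'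
  have hexam := examinedConst_pos hδ h1
  have hl2 := Real.log_pos one_lt_two
  have hlog := hl2.trans_le (log_two_le_log hn)
  have hd1 : (1 : ℝ) ≤ d := by exact_mod_cast hd
  -- For `n ≥ 2` this quotient is at least 1 and absorbs the additive constants.
  have h1log := one_le_log_div hn
  have hnatlog : (Nat.log 2 n : ℝ) ≤ Real.log n / Real.log 2 := by
    have := Real.natLog_le_logb n 2
    rwa [Real.logb, Nat.cast_ofNat] at this
  set x := (n : ℝ) ^ (Real.log P₁ / Real.log P₂)
  set y := Real.log n / Real.log 2 with hy
  have e1 : (numBits P₂ n * (8 * d + 4) : ℝ) ≤ bitsConst P₂ * Real.log n * (12 * d) := by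
    gcongr
    linarith
  have hyd : y ≤ y * d := le_mul_of_one_le_right (by linarith) hd1
  have e2 : (6 * (Nat.log 2 n + 1 : ℕ) + 7 : ℝ) ≤ 26 * (y * d) := by
    push_cast
    linarith
  have e3 : (8 * d + 8 : ℝ) ≤ 16 * (y * d) := by
    have : (d : ℝ) ≤ y * d := le_mul_of_one_le_left (by linarith) h1log
    linarith
  calc _ ≤ tablesConst δ P₁ * x * (bitsConst P₂ * Real.log n * (12 * d) + 26 * (y * d)) +
        examinedConst δ P₁ * x * (16 * (y * d)) := by gcongr
    _ = timeConst δ P₁ P₂ * (x * d * Real.log n) := by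
      rw [hy, timeConst]
      ring

end

theorem rho_lt_one {P₁ P₂ : ℝ} (h2 : 0 < P₂) (h12 : P₂ < P₁) (h2' : P₂ < 1) :
    Real.log P₁ / Real.log P₂ < 1 :=
  (div_lt_one_of_neg (Real.log_neg h2 h2')).2 (Real.log_lt_log h2 h12)

end ThetaALSH

/-- The constant and parameters are chosen before `d`, `M`, `w` and the data, so they can depend
only on `δ`, `P₁`, `P₂` and, for the parameters, `n`. Space and time hold for every seed; only
correctness is probabilistic. -/
theorem theorem5 (δ : ℝ) (hδ : 0 < δ) :
    ∃ (C : ℝ → ℝ → ℝ) (k L cap : ℝ → ℝ → ℕ → ℕ),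
      ∀ (d M : ℕ) (w : Fin d → ℝ) (R₁ R₂ P₁ P₂ ρ : ℝ),
        0 < d → 0 < M → w ≠ 0 → R₁ < R₂ →
        ThetaALSH.cosAngle M w R₁ ≤ 1 → -1 < ThetaALSH.cosAngle M w R₂ →
        P₁ = ThetaALSH.collisionProb M w R₁ →
        P₂ = ThetaALSH.collisionProb M w R₂ →
        ρ = ThetaALSH.rho M w R₁ R₂ →
        -- `collisionProb` is the collision probability function of the hash family
        (∀ o q : ThetaALSH.Point d M,
          (ThetaALSH.directionLaw d M).real
              {a | ThetaALSH.hashData a o = ThetaALSH.hashQuery a w q} =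
            ThetaALSH.collisionProb M w (ThetaALSH.wdist w o q)) ∧
        ρ < 1 ∧
        ∀ n : ℕ, 2 ≤ n →
          -- a packed key is an integer of `O(log n)` bits
          (k P₁ P₂ n : ℝ) ≤ C P₁ P₂ * Real.log n ∧
          ∀ D : Fin n → ThetaALSH.Point d M,
            -- space
            (∀ a : ThetaALSH.Seeds d M (k P₁ P₂ n) (L P₁ P₂ n),
              ((ThetaALSH.build D a).bucketCells : ℝ) ≤ C P₁ P₂ * (n : ℝ) ^ (1 + ρ) ∧
              ((ThetaALSH.build D a).cells : ℝ) ≤ C P₁ P₂ * (d * M) * (n : ℝ) ^ (1 + ρ)) ∧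
            ∀ q : ThetaALSH.Point d M,
              -- query time, in the worst case
              (∀ a : ThetaALSH.Seeds d M (k P₁ P₂ n) (L P₁ P₂ n),
                ((ThetaALSH.query (cap P₁ P₂ n) (ThetaALSH.build D a) w q R₂).steps : ℝ) ≤
                  C P₁ P₂ * ((n : ℝ) ^ ρ * d * Real.log n)) ∧
              -- correctness
              1 - δ ≤ (ThetaALSH.seedLaw d M (k P₁ P₂ n) (L P₁ P₂ n)).real
                {a | ThetaALSH.IsCorrectAnswer w R₁ R₂ D q
                  (ThetaALSH.query (cap P₁ P₂ n) (ThetaALSH.build D a) w q R₂).val} := by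
  -- The sum of three positive constants dominates each of them, so one `C` serves all bounds.
  open ThetaALSH in
  refine ⟨fun P₁ P₂ => bitsConst P₂ + spaceConst δ P₁ P₂ + timeConst δ P₁ P₂,
    fun _ P₂ n => numBits P₂ n, numTables δ, numExamined δ, ?_⟩
  intro d M w R₁ R₂ P₁ P₂ ρ hd hM hw hR hc1 hc2 hP₁ hP₂ hρ
  have h12 : P₂ < P₁ := by
    rw [hP₁, hP₂]
    exact collisionProb_lt hd hM hw hR hc1 hc2
  have h2 : 0 < P₂ := hP₂ ▸ collisionProb_pos hc2
  have h1' : P₁ ≤ 1 := hP₁ ▸ collisionProb_le_one w R₁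
  have h1 := h2.trans h12
  have h2' := h12.trans_le h1'
  replace hρ : ρ = Real.log P₁ / Real.log P₂ := by rw [hρ, rho, hP₁, hP₂]
  have hbits := bitsConst_pos h2 h2'
  have hspace := spaceConst_pos δ h1 h2 h2'
  have htime := timeConst_pos hδ h1 h2 h2'
  refine ⟨directionLaw_hashData_eq_hashQuery hd hM hw, hρ ▸ rho_lt_one h2 h12 h2',
    fun n hn => ⟨?_, fun D => ⟨fun a => ⟨?_, ?_⟩, fun q => ⟨fun a => ?_, ?_⟩⟩⟩⟩
  · refine (numBits_le h2 h2' hn).trans ?_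
    have := Real.log_natCast_nonneg n
    gcongr
    linarith
  · rw [Index.bucketCells, hρ]
    push_cast
    refine (bucket_bound h1 h1' h2 h2' hn).trans ?_
    gcongr
    have := tablesConst_pos δ h1
    have : 2 * tablesConst δ P₁ ≤ spaceConst δ P₁ P₂ := by
      unfold spaceConst
      have : 0 < 4 * (tablesConst δ P₁ * bitsConst P₂) := by positivity
      linarith
    linarith
  · rw [Index.cells, Index.bucketCells, hρ]
    push_cast
    refine (space_bound h1 h1' h2 h2' hn hd hM).trans ?_
    gcongr
    linarith
  · have hsteps := query_steps (build D a) w q R₂ (numExamined δ P₁ P₂ n)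
      (Nat.lt_pow_succ_log_self one_lt_two n)
    rw [hρ]
    refine (Nat.cast_le.2 hsteps).trans ?_
    have hbound := time_bound hδ h1 h1' h2 h2' hn hd
    push_cast at hbound ⊢
    refine hbound.trans ?_
    have := Real.log_natCast_nonneg n
    gcongr
    linarith
  · have hfail := failure_bound hδ h1 h1' h2 h2' hn
    have hsucc := seedLaw_isCorrectAnswer hd hM hw (numBits P₂ n) (numTables δ P₁ P₂ n) D q hR.le
      (hP₂ ▸ h2.le) (cap := numExamined δ P₁ P₂ n) (Nat.succ_pos _)
    rw [← hP₁, ← hP₂] at hsucc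
    exact le_trans (by linarith) hsucc
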